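/- \textbf{Setting.} Let $\lambda$ be the security parameter, $n=n(\lambda)\ge 1$ with $n(\lambda)=o(\lambda)$, and $N=N(\lambda)=2^{n+1}-1$ (so $N\in 2^{o(\lambda)}$). The CP graph $G_n$ has as nodes the bit strings of length at most $n$, with an edge from $v\|0$ and from $v\|1$ to $v$ whenever $|v|<n$, and an edge from $w\|0$ to every leaf $u\in\{0,1\}^n$ of the form $u=w\|1\|w'$; $\mathsf{parent}(v)$ is the set of nodes with an edge to $v$. Let $\mathsf H:\{0,1\}^*\to\{0,1\}^\lambda$ be a random oracle and $\mathsf H_x(\cdot)=\mathsf H(x\|\cdot)$. On a statement $x$ the label of a node $v$ with $\mathsf{parent}(v)=\{k_1,\dots,k_j\}$ (in a fixed order) is $s_v=\mathsf H_x(v\|s_{k_1}\|\cdots\|s_{k_j})$. Let $p_v$ be the prime with index $s_v$ among the first $2^\lambda$ primes, and $p_0$ the prime with index $\mathsf H_x(0^n)$. The \emph{CP construction} commits to the label of the root of $G_n$. The \emph{single-query PoSW} has as public parameter a modulus $\Delta$, sampled from any distribution on products of two safe primes that are superpolynomially large (for every $c$ and all large $\lambda$, every modulus in the support is at least $\lambda^c$),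 and commits to $\phi=f(p_0,\rho)=p_0^{\rho}\bmod\Delta$, where $\rho=\prod_v p_v$ is the product over all $N$ nodes. In both cases write $\phi=\mathsf{Solve}^{\mathsf H}(\mathbf{pp},x)$. The statement $x$ is uniform in a finite non-empty set $\mathcal X_\lambda\subseteq\{0,1\}^*$ with $|\mathcal X_\lambda|\ge(\lambda+N)^c$ for every $c$ and all large $\lambda$. A parallel adversary $\mathcal A=(\mathcal A_0,\mathcal A_1)$ with bounds $(t,\delta,w)$ is a non-uniform randomized pair of algorithms with access to $\mathsf H$: $\mathcal A_0$ maps $\mathbf{pp}$ to a state with at most $t(\lambda)$ queries, and $\mathcal A_1$ maps the state and $x$ to an output with at most $\delta(\lambda)$ rounds of at most $w(\lambda)$ parallel queries each. Only oracle queries are counted; all other computation, in particular the evaluation of $f$, is free. Its success probability is the probability, over $\mathbf{pp}$, $\mathsf H$, $x$ and the coins, that the output equals $\mathsf{Solve}^{\mathsf H}(\mathbf{pp},x)$. It \emph{breaks the sequentiality with probability $p_{win}$} if $t$ and $w$ are at most polynomial in $\lambda$ and $N$, $\delta<N$, and its success probability $p_{win}=p_{win}(\lambda)$ is not negligible in $\lambda$.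 A scheme is \emph{$\delta$-sequential} if every such adversary with $t,w$ polynomial in $\lambda,N$ and with $\delta$ rounds has negligible success probability. \textbf{Theorem.} \begin{enumerate} \item If $\mathcal A$, with bounds $(t,\delta,w)$, breaks the sequentiality of the single-query PoSW with probability $p_{win}$, then there is an attacker $\mathcal A'_{\mathtt{CP}}$, with the same bounds $(t,\delta,w)$, that breaks the sequentiality of the CP construction with the same probability $p_{win}$. \item In the random oracle model the single-query PoSW is $\delta$-sequential for every $\delta$ with $\delta(\lambda)<N(\lambda)$ for all $\lambda$, although the evaluation of $f$ is free. \end{enumerate} -/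

import Mathlib

open Filter Asymptotics MeasureTheory

/-! ## The CP graph

The nodes of the graph of depth `n` are the bit strings of length at most `n`; the root is the empty
string and the leaves are the strings of length `n`. The number of nodes is `2 ^ (n + 1) - 1`. -/

/-- The edge relation of the CP graph of depth `n`: `CPEdge n u v` says that there is an edge from
`u` to `v`. The first kind are the edges of the binary tree, pointing to the root; the second kind
go to a leaf `v` from every left sibling of a node on the path from `v` to the root. -/
def CPEdge (n : ℕ) (u v : List Bool) : Prop :=
  (v.length < n ∧ (u = v ++ [false] ∨ u = v ++ [true])) ∨
    (v.length = n ∧ ∃ w t : List Bool, v = w ++ true :: t ∧ u = w ++ [false])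

/-- The left siblings of the nodes on the path from the root to `v`, from the top down. -/
def leftSiblings : List Bool → List (List Bool)
  | [] => []
  | b :: v => (if b then [[false]] else []) ++ (leftSiblings v).map (List.cons b)

/-- The parents of `v` in the CP graph of depth `n`, in a fixed order. -/
def cpParents (n : ℕ) (v : List Bool) : List (List Bool) :=
  if v.length < n then [v ++ [false], v ++ [true]]
  else if v.length = n then leftSiblings v
  else []

theorem mem_leftSiblings (v u : List Bool) :
    u ∈ leftSiblings v ↔ ∃ w t : List Bool, v = w ++ true :: t ∧ u = w ++ [false] := by
  induction v generalizing u with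
  | nil => simp [leftSiblings]
  | cons b v ih =>
    simp only [leftSiblings, List.mem_append, List.mem_map, ih]
    constructor
    · rintro (h | ⟨_, ⟨w, t, rfl, rfl⟩, rfl⟩)
      · cases b
        · simp at h
        · simp at h
          exact ⟨[], v, by simp, by simp [h]⟩
      · exact ⟨b :: w, t, by simp, by simp⟩
    · rintro ⟨w, t, h, rfl⟩
      cases w with
      | nil =>
        simp at h
        left
        simp [h.1]
      | cons c w =>
        simp only [List.cons_append, List.cons.injEq] at h
        obtain ⟨rfl, rfl⟩ := h
        exact Or.inr ⟨_, ⟨w, t, rfl, rfl⟩, by simp⟩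

/-- The list `cpParents n v` enumerates exactly the parents of `v`. -/
theorem mem_cpParents (n : ℕ) (v u : List Bool) : u ∈ cpParents n v ↔ CPEdge n u v := by
  unfold cpParents CPEdge
  split_ifs with h1 h2
  · simp [h1, h1.ne]
  · simp [h2, mem_leftSiblings]
  · simp [h1, h2]

/-- The position (from `1` to `2 ^ (n + 1) - 1`) of a node in the topological order in which the
graph of depth `n` is labelled. -/
def cpIndex : ℕ → List Bool → ℕ
  | n, [] => 2 ^ (n + 1) - 1
  | 0, _ :: _ => 0
  | n + 1, false :: v => cpIndex n v
  | n + 1, true :: v => (2 ^ (n + 1) - 1) + cpIndex n v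

theorem cpIndex_nil (n : ℕ) : cpIndex n [] = 2 ^ (n + 1) - 1 := by
  cases n <;> rfl

theorem cpIndex_pos (n : ℕ) (v : List Bool) (h : v.length ≤ n) : 0 < cpIndex n v := by
  induction v generalizing n with
  | nil =>
    rw [cpIndex_nil]
    have : 2 ^ 1 ≤ 2 ^ (n + 1) := Nat.pow_le_pow_right (by norm_num) (by omega)
    omega
  | cons b v ih =>
    cases n with
    | zero => simp at h
    | succ n =>
      have := ih n (by simpa using h)
      cases b <;> simp only [cpIndex] <;> omega

theorem cpIndex_child (n : ℕ) (v : List Bool) (b : Bool) (h : v.length < n) :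
    cpIndex n (v ++ [b]) < cpIndex n v := by
  induction v generalizing n with
  | nil =>
    cases n with
    | zero => simp at h
    | succ n =>
      have h1 : 2 ^ 1 ≤ 2 ^ (n + 1) := Nat.pow_le_pow_right (by norm_num) (by omega)
      have h2 : 2 ^ (n + 1 + 1) = 2 * 2 ^ (n + 1) := by ring
      cases b <;> simp only [List.nil_append, cpIndex, cpIndex_nil] <;> omega
  | cons c v ih =>
    cases n with
    | zero => simp at h
    | succ n =>
      have := ih n (by simpa using h)
      cases c <;> simp only [List.cons_append, cpIndex] <;> omega

theorem cpIndex_leftSibling (n : ℕ) (v u : List Bool) (h : v.length ≤ n)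
    (hu : u ∈ leftSiblings v) : cpIndex n u < cpIndex n v := by
  induction v generalizing n u with
  | nil => simp [leftSiblings] at hu
  | cons b v ih =>
    cases n with
    | zero => simp at h
    | succ n =>
      have hv : v.length ≤ n := by simpa using h
      simp only [leftSiblings, List.mem_append, List.mem_map] at hu
      rcases hu with hu | ⟨u, hu, rfl⟩
      · cases b
        · simp at hu
        · simp at hu
          subst hu
          have := cpIndex_pos n v hv
          simp only [cpIndex, cpIndex_nil]
          omega
      · have := ih n u hv hu
        cases b <;> simp only [cpIndex] <;> omega

theorem cpIndex_parent (n : ℕ) (v u : List Bool) (hu : u ∈ cpParents n v) :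
    cpIndex n u < cpIndex n v := by
  unfold cpParents at hu
  split_ifs at hu with h1 h2
  · simp only [List.mem_cons, List.not_mem_nil, or_false] at hu
    rcases hu with rfl | rfl <;> exact cpIndex_child n v _ h1
  · exact cpIndex_leftSibling n v u h2.le hu
  · simp at hu

/-- The set of nodes of the CP graph of depth `n`. -/
def cpNodes (n : ℕ) : Finset (List Bool) :=
  (Finset.range (n + 1)).biUnion fun k =>
    (Finset.univ : Finset (Fin k → Bool)).image List.ofFn

theorem mem_cpNodes (n : ℕ) (v : List Bool) : v ∈ cpNodes n ↔ v.length ≤ n := by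
  simp only [cpNodes, Finset.mem_biUnion, Finset.mem_range, Finset.mem_image, Finset.mem_univ,
    true_and]
  constructor
  · rintro ⟨k, hk, b, rfl⟩
    simpa using Nat.lt_succ_iff.mp hk
  · intro h
    exact ⟨v.length, Nat.lt_succ_iff.mpr h, v.get, List.ofFn_get v⟩

/-! ## The random oracle and the labelling -/

/-- Labels are `lam`-bit strings. -/
abbrev Label (lam : ℕ) : Type := Fin lam → Bool

/-- A map from all bit strings to `lam`-bit strings. -/
abbrev Oracle (lam : ℕ) : Type := List Bool → Label lam

/-- The law of the random oracle: independent uniform values at all bit strings. -/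
noncomputable def oracleMeasure (lam : ℕ) : Measure (Oracle lam) :=
  Measure.infinitePi fun _ : List Bool => (PMF.uniformOfFintype (Label lam)).toMeasure

/-- The label of the node `v` of the CP graph of depth `n` on the statement `x`: the value of
`H_x = H (x ‖ ·)` at `v` followed by the labels of the parents of `v`. -/
def cpLabel {lam : ℕ} (H : Oracle lam) (x : List Bool) (n : ℕ) (v : List Bool) : Label lam :=
  H (x ++ (v ++ (cpParents n v).attach.flatMap fun u => List.ofFn (cpLabel H x n u.1)))
termination_by cpIndex n v
decreasing_by exact cpIndex_parent n v u.1 u.2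

theorem cpLabel_eq {lam : ℕ} (H : Oracle lam) (x : List Bool) (n : ℕ) (v : List Bool) :
    cpLabel H x n v =
      H (x ++ (v ++ (cpParents n v).flatMap fun u => List.ofFn (cpLabel H x n u))) := by
  rw [cpLabel]
  congr 3
  simp [List.flatMap]

/-- The prime that a `lam`-bit string stands for. This is a bijection from the `lam`-bit strings
to the set of the first `2 ^ lam` primes, so that `labelPrime ∘ H` is a random oracle with values
in that set; in a query, a prime is written as the `lam`-bit string that stands for it. -/
noncomputable def labelPrime {lam : ℕ} (s : Label lam) : ℕ :=
  Nat.nth Nat.Prime (Nat.ofBits s)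

/-! ## Proofs of sequential work -/

/-- The part of a proof of sequential work in the random oracle model that its sequentiality is
about: the time parameter `N` as a function of the security parameter, the parameter generation
`Gen`, and the commitment that `Solve` computes from the parameters and the statement. -/
structure PoSW where
  /-- public parameters -/
  Param : Type
  /-- commitments -/
  Comm : Type
  /-- the time parameter `N` -/
  time : ℕ → ℕ
  /-- `Gen`, as the law of its output -/
  gen : ℕ → PMF Param
  /-- the commitment computed by `Solve`, on public parameters, an oracle and a statement -/
  solve : (lam : ℕ) → Param → Oracle lam → List Bool → Comm

/-- The CP construction on the graph of depth `n lam`: the commitment is the label of the root. -/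
noncomputable def cpPoSW (n : ℕ → ℕ) : PoSW where
  Param := Unit
  Comm := List Bool
  time lam := 2 ^ (n lam + 1) - 1
  gen _ := PMF.pure ()
  solve lam _ H x := List.ofFn (cpLabel H x (n lam) [])

/-- The single-query verifiable proof of sequential work on the graph of depth `n lam`, with a
public modulus `m` sampled from `modulus lam`: with `p₀` the prime `H_x (0 ^ n)` and `ρ` the
product of the prime labels of all nodes, the commitment is `p₀ ^ ρ mod m`. -/
noncomputable def singleQueryPoSW (n : ℕ → ℕ) (modulus : ℕ → PMF ℕ) : PoSW where
  Param := ℕ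
  Comm := ℕ
  time lam := 2 ^ (n lam + 1) - 1
  gen := modulus
  solve lam m H x :=
    labelPrime (H (x ++ List.replicate (n lam) false)) ^
      (∏ v ∈ cpNodes (n lam), labelPrime (cpLabel H x (n lam) v)) % m

/-- `m` is the product of two safe primes. -/
def IsSafePrimeProduct (m : ℕ) : Prop :=
  ∃ p q : ℕ, (p.Prime ∧ ∃ p' : ℕ, p'.Prime ∧ p = 2 * p' + 1) ∧
    (q.Prime ∧ ∃ q' : ℕ, q'.Prime ∧ q = 2 * q' + 1) ∧ m = p * q

/-! ## Parallel adversaries -/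

/-- An algorithm with access to an oracle with answers in `L`, and with output in `α`. It runs in
rounds: in each round it submits finitely many queries in parallel and then sees all the answers.
Computation other than oracle queries is free. -/
inductive OracleAlg (L α : Type) : Type
  | ret (a : α) : OracleAlg L α
  | round (k : ℕ) (qs : Fin k → List Bool) (next : (Fin k → L) → OracleAlg L α) : OracleAlg L α

namespace OracleAlg

variable {L α : Type}

/-- The output of the algorithm with the oracle `H`. -/
def run (H : List Bool → L) : OracleAlg L α → α
  | ret a => a
  | round _ qs next => (next fun i => H (qs i)).run H

/-- The algorithm makes at most `d` rounds of queries, whatever the answers are. -/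
def RoundsLE : OracleAlg L α → ℕ → Prop
  | ret _, _ => True
  | round _ _ next, d => 1 ≤ d ∧ ∀ a, (next a).RoundsLE (d - 1)

/-- The algorithm makes at most `w` queries in each round. -/
def WidthLE : OracleAlg L α → ℕ → Prop
  | ret _, _ => True
  | round k _ next, w => k ≤ w ∧ ∀ a, (next a).WidthLE w

/-- The algorithm makes at most `t` queries altogether. -/
def QueriesLE : OracleAlg L α → ℕ → Prop
  | ret _, _ => True
  | round k _ next, t => k ≤ t ∧ ∀ a, (next a).QueriesLE (t - k)

end OracleAlg

/-- A non-uniform randomized adversary against the sequentiality of `P`: a preprocessing algorithm,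
which turns the public parameters into a state, and an online algorithm, which turns the state and
the statement into a commitment. Both may query the oracle, and each has a tape of fair coins. -/
structure Adversary (P : PoSW) where
  /-- number of coins of the preprocessing algorithm -/
  preCoins : ℕ → ℕ
  /-- number of coins of the online algorithm -/
  coins : ℕ → ℕ
  /-- the preprocessing algorithm -/
  pre : (lam : ℕ) → P.Param → (Fin (preCoins lam) → Bool) → OracleAlg (Label lam) (List Bool)
  /-- the online algorithm, on a state and a statement -/
  online : (lam : ℕ) → List Bool → List Bool → (Fin (coins lam) → Bool) →
    OracleAlg (Label lam) P.Comm

namespace Adversary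

variable {P : PoSW}

/-- The preprocessing makes at most `t lam` queries, and the online algorithm makes at most `δ lam`
rounds of queries with at most `w lam` parallel queries in each of them. -/
def RunsWithin (A : Adversary P) (t δ w : ℕ → ℕ) : Prop :=
  (∀ lam pp r, (A.pre lam pp r).QueriesLE (t lam)) ∧
    ∀ lam state x r, (A.online lam state x r).RoundsLE (δ lam) ∧
      (A.online lam state x r).WidthLE (w lam)

/-- The joint law of the public parameters, the statement (uniform in `X lam`) and the two tapes. -/
noncomputable def setup (A : Adversary P) (X : ℕ → Finset (List Bool))
    (hX : ∀ lam, (X lam).Nonempty) (lam : ℕ) :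
    PMF (P.Param × List Bool × (Fin (A.preCoins lam) → Bool) × (Fin (A.coins lam) → Bool)) := do
  let pp ← P.gen lam
  let x ← PMF.uniformOfFinset (X lam) (hX lam)
  let r₀ ← PMF.uniformOfFintype (Fin (A.preCoins lam) → Bool)
  let r₁ ← PMF.uniformOfFintype (Fin (A.coins lam) → Bool)
  pure (pp, x, r₀, r₁)

/-- The probability, over the random oracle and the setup, that the online algorithm outputs the
commitment that `Solve` computes. -/
noncomputable def success (A : Adversary P) (X : ℕ → Finset (List Bool))
    (hX : ∀ lam, (X lam).Nonempty) (lam : ℕ) : ℝ :=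
  (∑' e, A.setup X hX lam e *
    oracleMeasure lam {H | (A.online lam ((A.pre lam e.1 e.2.2.1).run H) e.2.1 e.2.2.2).run H =
      P.solve lam e.1 H e.2.1}).toReal

end Adversary

/-- `f` is negligible: it tends to zero faster than every inverse power of its argument. -/
def Negligible (f : ℕ → ℝ) : Prop :=
  SuperpolynomialDecay atTop (fun lam : ℕ => (lam : ℝ)) f

/-- `t` is bounded by a polynomial in the security parameter and the time parameter. -/
def PolyBounded (N t : ℕ → ℕ) : Prop :=
  ∃ c : ℕ, ∀ lam, t lam ≤ c * (lam + N lam) ^ c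

namespace PoSW

/-- `A`, with polynomially many preprocessing queries `t` and processors `w` and with `δ < N`
rounds, breaks the sequentiality of `P` with probability `pwin`, a non-negligible function of the
security parameter. -/
def BreaksSequentiality (P : PoSW) (X : ℕ → Finset (List Bool)) (hX : ∀ lam, (X lam).Nonempty)
    (t δ w : ℕ → ℕ) (A : Adversary P) (pwin : ℕ → ℝ) : Prop :=
  PolyBounded P.time t ∧ PolyBounded P.time w ∧ (∀ lam, δ lam < P.time lam) ∧
    A.RunsWithin t δ w ∧ (∀ lam, A.success X hX lam = pwin lam) ∧ ¬ Negligible pwin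

/-- `P` is `δ`-sequential: every adversary with polynomially many preprocessing queries and
processors and with `δ` rounds has negligible success. -/
def IsSequential (P : PoSW) (X : ℕ → Finset (List Bool)) (hX : ∀ lam, (X lam).Nonempty)
    (δ : ℕ → ℕ) : Prop :=
  ∀ (t w : ℕ → ℕ) (A : Adversary P), PolyBounded P.time t → PolyBounded P.time w →
    A.RunsWithin t δ w → Negligible (A.success X hX)

end PoSW

/-! ## Combinatorics of the CP graph -/

/-! The substance is the sequentiality of the single-query scheme; the reduction to CP then holds
vacuously, since no adversary satisfies its hypothesis.

Fix the modulus `m`, the statement and the coins. The order given by `cpIndex` is a Hamiltonian path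
of the graph (`exists_cpParent_cpIndex`), and the query of a node spells out the labels of its
parents. So a node queried before its predecessor on the path costs a guess of a fresh uniform label
(`oracleMeasure_guess_le`). The preprocessing, which does not know the statement, rarely asks a
query belonging to it (`sum_oracleMeasure_touches_le`). Outside these events each round advances at
most one step along the path, so with fewer than `N` rounds the root is never queried
(`cpIndex_le_of_mem_roundQueries`).

The free evaluation of `f` does not help then (`oracleMeasure_final_le`). Resampling the root label
leaves the output, the base `p₀` and the product `r` of the other primes unchanged. Let `q = 2 q' +
1` be the larger safe prime factor of `m`. If `p₀` is not `0` or `±1` modulo `q`, its order is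
divisible by `q'`; if moreover no other label prime is `q'`, then `p₀ ^ r` together with the output
fixes the root prime modulo `q'`. Few of the first `2 ^ lam` primes share a residue modulo a
superpolynomial `q'`, by Chebyshev's bound on their size.

Every probability estimate comes from one principle, `oracleMeasure_le_of_resample`: resample the
oracle at a point whose location does not depend on its value there. -/

theorem cpIndex_append_true (n : ℕ) (v : List Bool) (h : v.length < n) :
    cpIndex n (v ++ [true]) + 1 = cpIndex n v := by
  induction v generalizing n with
  | nil =>
    cases n with
    | zero => simp at h
    | succ n =>
      have h1 : 2 ^ 1 ≤ 2 ^ (n + 1) := Nat.pow_le_pow_right (by norm_num) (by omega)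
      have h2 : 2 ^ (n + 1 + 1) = 2 * 2 ^ (n + 1) := by ring
      simp only [List.nil_append, cpIndex, cpIndex_nil]
      omega
  | cons c v ih =>
    cases n with
    | zero => simp at h
    | succ n =>
      have := ih n (by simpa using h)
      cases c <;> simp only [List.cons_append, cpIndex] <;> omega

/-- `cpIndex` is the post-order of the tree. Just before a leaf comes the root of the subtree
completed last, which hangs off to the left at the last `true` bit of the leaf. -/
theorem exists_leftSibling_cpIndex (v : List Bool) (h : 1 < cpIndex v.length v) :
    ∃ u ∈ leftSiblings v, cpIndex v.length u + 1 = cpIndex v.length v := by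
  induction v with
  | nil => simp [cpIndex] at h
  | cons b v ih =>
    cases b
    · simp only [List.length_cons, cpIndex] at h ⊢
      obtain ⟨u, hu, hi⟩ := ih h
      exact ⟨false :: u, by simpa [leftSiblings] using hu, by simpa [cpIndex] using hi⟩
    · simp only [List.length_cons, cpIndex] at h ⊢
      by_cases h1 : 1 < cpIndex v.length v
      · obtain ⟨u, hu, hi⟩ := ih h1
        exact ⟨true :: u, by simp [leftSiblings, hu], by simp only [cpIndex]; omega⟩
      -- Here the leaf is the first node of the right subtree, so its predecessor is the root of the
      -- left subtree, the last node there.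
      · have := cpIndex_pos v.length v le_rfl
        exact ⟨[false], by simp [leftSiblings], by simp only [cpIndex, cpIndex_nil]; omega⟩

/-- The order of the indices is a Hamiltonian path of the CP graph. -/
theorem exists_cpParent_cpIndex (n : ℕ) (v : List Bool) (hv : v.length ≤ n)
    (h : 1 < cpIndex n v) : ∃ u ∈ cpParents n v, cpIndex n u + 1 = cpIndex n v := by
  rcases hv.lt_or_eq with hv | rfl
  · exact ⟨v ++ [true], by simp [cpParents, hv], cpIndex_append_true n v hv⟩
  · obtain ⟨u, hu, hi⟩ := exists_leftSibling_cpIndex v h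
    exact ⟨u, by simpa [cpParents] using hu, hi⟩

theorem length_le_of_mem_cpParents {n : ℕ} {v u : List Bool} (hu : u ∈ cpParents n v) :
    u.length ≤ n := by
  rw [mem_cpParents] at hu
  rcases hu with ⟨h, rfl | rfl⟩ | ⟨h, w, t, rfl, rfl⟩
  · simpa using h
  · simpa using h
  · simp at h ⊢
    omega

theorem cpIndex_lt_root (n : ℕ) (v : List Bool) (hv : v.length ≤ n) (h : v ≠ []) :
    cpIndex n v < cpIndex n [] := by
  obtain ⟨w, b, rfl⟩ := (List.eq_nil_or_concat v).resolve_left h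
  induction w using List.reverseRecOn generalizing b with
  | nil => exact cpIndex_child n [] b (by simpa [Nat.succ_le_iff] using hv)
  | append_singleton w c ih =>
    simp only [List.concat_eq_append] at *
    simp only [List.length_append, List.length_singleton] at hv ih
    exact (cpIndex_child n _ b (by simp; omega)).trans (ih c (by omega) (by simp))

theorem length_leftSiblings_le (v : List Bool) : (leftSiblings v).length ≤ v.length := by
  induction v with
  | nil => simp [leftSiblings]
  | cons b v ih => cases b <;> simp [leftSiblings] <;> omega

theorem length_cpParents_le (n : ℕ) (v : List Bool) : (cpParents n v).length ≤ n + 1 := by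
  unfold cpParents
  split_ifs with h1 h2
  · simp; omega
  · have := length_leftSiblings_le v
    omega
  · simp

theorem leftSiblings_replicate_false (n : ℕ) : leftSiblings (List.replicate n false) = [] := by
  induction n with
  | zero => simp [leftSiblings]
  | succ n ih => simp [List.replicate_succ, leftSiblings, ih]

theorem cpParents_replicate_false (n : ℕ) : cpParents n (List.replicate n false) = [] := by
  simp [cpParents, leftSiblings_replicate_false]

theorem card_cpNodes_le (n : ℕ) : (cpNodes n).card ≤ 2 ^ (n + 1) - 1 := by
  refine Finset.card_biUnion_le.trans ?_
  have : ∀ m : ℕ, ∑ k ∈ Finset.range m, ((Finset.univ : Finset (Fin k → Bool)).image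
      List.ofFn).card ≤ 2 ^ m - 1 := by
    intro m
    induction m with
    | zero => simp
    | succ m ih =>
      rw [Finset.sum_range_succ]
      have h1 : ((Finset.univ : Finset (Fin m → Bool)).image List.ofFn).card ≤ 2 ^ m :=
        Finset.card_image_le.trans (by simp)
      have h2 := Nat.one_le_two_pow (n := m)
      rw [pow_succ]
      omega
  exact this (n + 1)

/-! ## The queries of the labelling -/

section Query

variable {lam : ℕ}

/-- The string whose hash is the label of the node `v`. -/
noncomputable def cpQuery (H : Oracle lam) (x : List Bool) (n : ℕ) (v : List Bool) : List Bool :=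
  x ++ (v ++ (cpParents n v).flatMap fun u => List.ofFn (cpLabel H x n u))

theorem cpLabel_eq_cpQuery (H : Oracle lam) (x : List Bool) (n : ℕ) (v : List Bool) :
    cpLabel H x n v = H (cpQuery H x n v) := cpLabel_eq H x n v

theorem length_flatMap_ofFn (l : List (List Bool)) (f : List Bool → Label lam) :
    (l.flatMap fun u => List.ofFn (f u)).length = lam * l.length := by
  induction l with
  | nil => simp
  | cons a l ih => simp [ih]; ring

theorem eq_of_flatMap_ofFn_eq {l : List (List Bool)} {f g : List Bool → Label lam}
    (h : (l.flatMap fun u => List.ofFn (f u)) = l.flatMap fun u => List.ofFn (g u))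
    {u : List Bool} (hu : u ∈ l) : f u = g u := by
  induction l with
  | nil => simp at hu
  | cons a l ih =>
    simp only [List.flatMap_cons] at h
    obtain ⟨h1, h2⟩ := List.append_inj h (by simp)
    rcases List.mem_cons.mp hu with rfl | hu
    · exact List.ofFn_injective h1
    · exact ih h2 hu

theorem length_cpQuery (H : Oracle lam) (x : List Bool) (n : ℕ) (v : List Bool) :
    (cpQuery H x n v).length = x.length + (v.length + lam * (cpParents n v).length) := by
  simp only [cpQuery, List.length_append, length_flatMap_ofFn]

/-- Labels occupy blocks of `lam` bits and a node has fewer than `lam` bits, so the length of the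
query modulo `lam` reveals where the name of the node ends. Two different oracles are allowed. -/
theorem cpQuery_injective {n : ℕ} (hn : n < lam) {H H' : Oracle lam} {x u v : List Bool}
    (hu : u.length ≤ n) (hv : v.length ≤ n) (h : cpQuery H x n u = cpQuery H' x n v) : u = v := by
  have hl := congrArg List.length h
  rw [length_cpQuery, length_cpQuery, Nat.add_left_cancel_iff] at hl
  have hm := congrArg (· % lam) hl
  simp only [Nat.add_mul_mod_self_left] at hm
  rw [Nat.mod_eq_of_lt (by omega), Nat.mod_eq_of_lt (by omega)] at hm
  exact (List.append_inj (List.append_cancel_left h) hm).1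

theorem cpLabel_congr_parents_of_cpQuery_eq {n : ℕ} {H H' : Oracle lam} {x v u : List Bool}
    (h : cpQuery H x n v = cpQuery H' x n v) (hu : u ∈ cpParents n v) :
    cpLabel H x n u = cpLabel H' x n u :=
  eq_of_flatMap_ofFn_eq (List.append_cancel_left (List.append_cancel_left h)) hu

theorem cpQuery_congr {n : ℕ} {H H' : Oracle lam} {x v : List Bool}
    (h : ∀ u ∈ cpParents n v, cpLabel H x n u = cpLabel H' x n u) :
    cpQuery H x n v = cpQuery H' x n v := by
  have : ((cpParents n v).flatMap fun u => List.ofFn (cpLabel H x n u)) =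
      (cpParents n v).flatMap fun u => List.ofFn (cpLabel H' x n u) := by
    simp only [List.flatMap]
    congr 1
    exact List.map_congr_left fun u hu => by rw [h u hu]
  rw [cpQuery, cpQuery, this]

/-- Labels of smaller index do not depend on the value of the oracle at the query of `v`. -/
theorem cpLabel_update_of_lt {n : ℕ} (hn : n < lam) (H : Oracle lam) (x v : List Bool)
    (hv : v.length ≤ n) (s : Label lam) (u : List Bool) (hu : u.length ≤ n)
    (huv : cpIndex n u < cpIndex n v) :
    cpLabel (Function.update H (cpQuery H x n v) s) x n u = cpLabel H x n u := by
  induction hk : cpIndex n u using Nat.strong_induction_on generalizing u with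
  | _ k ih =>
    have hq : cpQuery (Function.update H (cpQuery H x n v) s) x n u = cpQuery H x n u :=
      cpQuery_congr fun w hw =>
        ih (cpIndex n w) (hk ▸ cpIndex_parent n u w hw) w (length_le_of_mem_cpParents hw)
          ((cpIndex_parent n u w hw).trans huv) rfl
    rw [cpLabel_eq_cpQuery, cpLabel_eq_cpQuery, hq, Function.update_of_ne]
    intro h
    rw [cpQuery_injective hn hu hv h] at huv
    exact lt_irrefl _ huv

theorem cpQuery_update {n : ℕ} (hn : n < lam) (H : Oracle lam) (x v : List Bool)
    (hv : v.length ≤ n) (s : Label lam) (u : List Bool)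
    (huv : cpIndex n u ≤ cpIndex n v) :
    cpQuery (Function.update H (cpQuery H x n v) s) x n u = cpQuery H x n u :=
  cpQuery_congr fun w hw => cpLabel_update_of_lt hn H x v hv s w (length_le_of_mem_cpParents hw)
    ((cpIndex_parent n u w hw).trans_le huv)

theorem cpLabel_update_self {n : ℕ} (hn : n < lam) (H : Oracle lam) (x v : List Bool)
    (hv : v.length ≤ n) (s : Label lam) :
    cpLabel (Function.update H (cpQuery H x n v) s) x n v = s := by
  rw [cpLabel_eq_cpQuery, cpQuery_update hn H x v hv s v le_rfl, Function.update_self]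

theorem cpQuery_replicate_false (H : Oracle lam) (x : List Bool) (n : ℕ) :
    cpQuery H x n (List.replicate n false) = x ++ List.replicate n false := by
  simp [cpQuery, cpParents_replicate_false]

/-- The query of every node extends the statement by at most this many bits. -/
theorem cpQuery_eq_append (H : Oracle lam) (x : List Bool) {n : ℕ} {v : List Bool}
    (hv : v.length ≤ n) : ∃ z : List Bool, cpQuery H x n v = x ++ z ∧
      z.length ≤ n + lam * (n + 1) := by
  refine ⟨_, rfl, ?_⟩
  rw [List.length_append, length_flatMap_ofFn]
  exact Nat.add_le_add hv (Nat.mul_le_mul_left _ (length_cpParents_le n v))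

end Query

/-! ## The queries of an algorithm -/

namespace OracleAlg

variable {L α : Type}

/-- The queries submitted in round `i` (counted from `0`) with the oracle `H`. -/
def roundQueries (H : List Bool → L) : OracleAlg L α → ℕ → List (List Bool)
  | ret _, _ => []
  | round _ qs _, 0 => List.ofFn qs
  | round _ qs next, i + 1 => (next fun j => H (qs j)).roundQueries H i

/-- All queries submitted with the oracle `H`. -/
def queries (H : List Bool → L) : OracleAlg L α → List (List Bool)
  | ret _ => []
  | round _ qs next => List.ofFn qs ++ (next fun j => H (qs j)).queries H

theorem roundQueries_congr {H H' : List Bool → L} (A : OracleAlg L α) (i : ℕ)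
    (h : ∀ j < i, ∀ y ∈ A.roundQueries H j, H' y = H y) :
    A.roundQueries H' i = A.roundQueries H i := by
  induction A generalizing i with
  | ret a => rfl
  | round k qs next ih =>
    cases i with
    | zero => rfl
    | succ i =>
      have h0 : (fun j => H' (qs j)) = fun j => H (qs j) := by
        funext j
        exact h 0 (by omega) _ (by simp [roundQueries])
      simp only [roundQueries, h0]
      exact ih _ i fun j hj y hy => h (j + 1) (by omega) y hy

theorem run_congr {H H' : List Bool → L} (A : OracleAlg L α)
    (h : ∀ y ∈ A.queries H, H' y = H y) : A.run H' = A.run H := by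
  induction A with
  | ret a => rfl
  | round k qs next ih =>
    have h0 : (fun j => H' (qs j)) = fun j => H (qs j) := by
      funext j
      exact h _ (by simp [queries])
    simp only [run, h0]
    exact ih _ fun y hy => h y (by simp [queries, hy])

theorem mem_queries_iff {H : List Bool → L} (A : OracleAlg L α) (y : List Bool) :
    y ∈ A.queries H ↔ ∃ i, y ∈ A.roundQueries H i := by
  induction A with
  | ret a => simp [queries, roundQueries]
  | round k qs next ih =>
    rw [queries, List.mem_append, ih]
    constructor
    · rintro (h | ⟨i, h⟩)
      · exact ⟨0, h⟩
      · exact ⟨i + 1, h⟩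
    · rintro ⟨_ | i, h⟩
      · exact Or.inl h
      · exact Or.inr ⟨i, h⟩

theorem RoundsLE.lt_of_mem {A : OracleAlg L α} {d : ℕ} (hA : A.RoundsLE d) {H : List Bool → L}
    {i : ℕ} {y : List Bool} (hy : y ∈ A.roundQueries H i) : i < d := by
  induction A generalizing i d with
  | ret a => simp [roundQueries] at hy
  | round k qs next ih =>
    obtain ⟨h1, h2⟩ := hA
    cases i with
    | zero => omega
    | succ i =>
      have := ih _ (h2 _) hy
      omega

theorem WidthLE.length_roundQueries_le {A : OracleAlg L α} {w : ℕ} (hA : A.WidthLE w)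
    (H : List Bool → L) (i : ℕ) : (A.roundQueries H i).length ≤ w := by
  induction A generalizing i with
  | ret a => simp [roundQueries]
  | round k qs next ih =>
    obtain ⟨h1, h2⟩ := hA
    cases i with
    | zero => simpa [roundQueries] using h1
    | succ i => exact ih _ (h2 _) i

theorem QueriesLE.length_queries_le {A : OracleAlg L α} {t : ℕ} (hA : A.QueriesLE t)
    (H : List Bool → L) : (A.queries H).length ≤ t := by
  induction A generalizing t with
  | ret a => simp [queries]
  | round k qs next ih =>
    obtain ⟨h1, h2⟩ := hA
    have := ih _ (h2 fun j => H (qs j))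
    simp only [queries, List.length_append, List.length_ofFn]
    omega

end OracleAlg

/-! ## Measurability -/

section Measurability

variable {lam : ℕ} {β γ : Type*}

/-- All preimages under `f` are events. -/
def OracleMeasurable (f : Oracle lam → β) : Prop := ∀ S : Set β, MeasurableSet (f ⁻¹' S)

namespace OracleMeasurable

theorem const (b : β) : OracleMeasurable fun _ : Oracle lam => b := fun _ =>
  measurable_const (MeasurableSpace.measurableSet_top (s := _))

theorem comp {f : Oracle lam → β} (hf : OracleMeasurable f) (g : β → γ) :
    OracleMeasurable fun H => g (f H) := fun S => hf (g ⁻¹' S)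

/-- Handles adaptive computation: split according to the countably many values of the first stage,
on each of which the second stage is a fixed measurable map. -/
theorem bind [Countable β] {f : Oracle lam → β} (hf : OracleMeasurable f)
    {g : β → Oracle lam → γ} (hg : ∀ b, OracleMeasurable (g b)) :
    OracleMeasurable fun H => g (f H) H := fun S => by
  have : (fun H => g (f H) H) ⁻¹' S = ⋃ b, f ⁻¹' {b} ∩ g b ⁻¹' S := by
    ext H
    simp
  rw [this]
  exact MeasurableSet.iUnion fun b => (hf _).inter (hg b S)

theorem pi {ι : Type*} [Finite ι] {f : Oracle lam → ι → Label lam}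
    (hf : ∀ i, OracleMeasurable fun H => f H i) : OracleMeasurable f := fun S =>
  (measurable_pi_iff.mpr fun i _ _ => hf i _) (Set.toFinite S).measurableSet

theorem eval (y : List Bool) : OracleMeasurable fun H : Oracle lam => H y := fun S =>
  measurable_pi_apply y (Set.toFinite S).measurableSet

theorem eval_comp {k : ℕ} (qs : Fin k → List Bool) :
    OracleMeasurable fun (H : Oracle lam) (i : Fin k) => H (qs i) :=
  pi fun i => eval (qs i)

theorem prod (s : Finset γ) {f : Oracle lam → γ → ℕ} (hf : ∀ v, OracleMeasurable fun H => f H v) :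
    OracleMeasurable fun H => ∏ v ∈ s, f H v := by
  classical
  induction s using Finset.induction_on with
  | empty => exact const 1
  | insert a s ha ih =>
    simp only [Finset.prod_insert ha]
    exact bind (hf a) (g := fun b H => b * ∏ v ∈ s, f H v) fun b => ih.comp (b * ·)

theorem setOf {p : Oracle lam → Prop} (hp : OracleMeasurable p) : MeasurableSet {H | p H} := by
  convert hp {True}
  ext H
  simp

theorem flatMap (l : List (List Bool)) {f : Oracle lam → List Bool → Label lam}
    (hf : ∀ u ∈ l, OracleMeasurable fun H => f H u) :
    OracleMeasurable fun H => l.flatMap fun u => List.ofFn (f H u) := by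
  induction l with
  | nil => exact const _
  | cons a l ih =>
    simp only [List.flatMap_cons]
    exact bind (hf a (by simp)) (g := fun b H => List.ofFn b ++ l.flatMap fun u => List.ofFn (f H u))
      fun b => (ih fun u hu => hf u (by simp [hu])).comp fun z => List.ofFn b ++ z

theorem cpLabel (x : List Bool) (n : ℕ) (v : List Bool) :
    OracleMeasurable fun H : Oracle lam => _root_.cpLabel H x n v := by
  induction hk : cpIndex n v using Nat.strong_induction_on generalizing v with
  | _ k ih =>
    have heq : (fun H : Oracle lam => _root_.cpLabel H x n v) = fun H => H (x ++ (v ++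
        (cpParents n v).flatMap fun u => List.ofFn (_root_.cpLabel H x n u))) :=
      funext fun H => cpLabel_eq H x n v
    rw [heq]
    have := flatMap (cpParents n v) (f := fun H u => _root_.cpLabel H x n u)
      fun u hu => ih _ (hk ▸ cpIndex_parent n v u hu) u rfl
    exact bind this (g := fun z H => H (x ++ (v ++ z))) fun z => eval _

theorem cpQuery (x : List Bool) (n : ℕ) (v : List Bool) :
    OracleMeasurable fun H : Oracle lam => _root_.cpQuery H x n v :=
  (flatMap (cpParents n v) (f := fun H u => _root_.cpLabel H x n u)
    fun u _ => cpLabel x n u).comp fun z => x ++ (v ++ z)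

theorem run {α : Type} (A : OracleAlg (Label lam) α) :
    OracleMeasurable fun H : Oracle lam => A.run H := by
  induction A with
  | ret a => exact const a
  | round k qs next ih => exact bind (eval_comp qs) (g := fun a H => (next a).run H) ih

theorem roundQueries {α : Type} (A : OracleAlg (Label lam) α) (i : ℕ) :
    OracleMeasurable fun H : Oracle lam => A.roundQueries H i := by
  induction A generalizing i with
  | ret a => exact const _
  | round k qs next ih =>
    cases i with
    | zero => exact const _
    | succ i =>
      exact bind (eval_comp qs) (g := fun a H => (next a).roundQueries H i) fun a => ih a i

theorem queries {α : Type} (A : OracleAlg (Label lam) α) :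
    OracleMeasurable fun H : Oracle lam => A.queries H := by
  induction A with
  | ret a => exact const _
  | round k qs next ih =>
    exact bind (eval_comp qs) (g := fun a H => List.ofFn qs ++ (next a).queries H)
      fun a => (ih a).comp _

theorem and {p q : Oracle lam → Prop} (hp : OracleMeasurable p) (hq : OracleMeasurable q) :
    OracleMeasurable fun H => p H ∧ q H :=
  bind hp (g := fun a H => a ∧ q H) fun _ => hq.comp _

theorem not {p : Oracle lam → Prop} (hp : OracleMeasurable p) :
    OracleMeasurable fun H => ¬ p H := hp.comp _

theorem mem {f : Oracle lam → List Bool} {g : Oracle lam → List (List Bool)}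
    (hf : OracleMeasurable f) (hg : OracleMeasurable g) :
    OracleMeasurable fun H => f H ∈ g H :=
  bind hf (g := fun a H => a ∈ g H) fun _ => hg.comp _

theorem all {ι : Type*} [Countable ι] {p : ι → Oracle lam → Prop}
    (hp : ∀ i, OracleMeasurable (p i)) : OracleMeasurable fun H => ∀ i, p i H := fun S => by
  have h : MeasurableSet {H | ∀ i, p i H} := by
    simp only [Set.ofPred_forall]
    exact MeasurableSet.iInter fun i => (hp i).setOf
  have h2 : Measurable[_, ⊤] fun H => ∀ i, p i H := by
    exact measurableSet_setOfPred.mp h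
  exact h2 trivial

end OracleMeasurable

end Measurability

/-! ## Resampling one value of the random oracle -/

section Resample

variable {lam : ℕ}

instance isProbabilityMeasure_oracleMeasure (lam : ℕ) :
    IsProbabilityMeasure (oracleMeasure lam) := by
  unfold oracleMeasure
  infer_instance

theorem measurable_update_oracle (y : List Bool) :
    Measurable fun p : Oracle lam × Label lam => Function.update p.1 y p.2 := by
  refine measurable_pi_iff.mpr fun z => ?_
  rcases eq_or_ne z y with rfl | h
  · simpa using measurable_snd
  · simp only [Function.update_of_ne h]
    exact (measurable_pi_apply z).comp measurable_fst

/-- Overwriting one coordinate of a product measure by an independent sample of the same law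
preserves it; it suffices to compare finite boxes. -/
theorem map_update_oracleMeasure (y : List Bool) :
    ((oracleMeasure lam).prod (PMF.uniformOfFintype (Label lam)).toMeasure).map
      (fun p => Function.update p.1 y p.2) = oracleMeasure lam := by
  have hm := measurable_update_oracle (lam := lam) y
  refine Measure.eq_infinitePi _ fun s t ht => ?_
  rw [Measure.map_apply hm (MeasurableSet.pi s.countable_toSet fun i _ => ht i)]
  have hpre : (fun p : Oracle lam × Label lam => Function.update p.1 y p.2) ⁻¹'
      (Set.pi s t) = Set.pi (s.erase y : Finset _) t ×ˢ (if y ∈ s then t y else Set.univ) := by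
    ext ⟨H, a⟩
    simp only [Set.mem_preimage, Set.mem_pi, Finset.mem_coe, Set.mem_prod, Finset.mem_erase]
    constructor
    · intro h
      refine ⟨fun i hi => by simpa [hi.1] using h i hi.2, ?_⟩
      split_ifs with hy
      · simpa using h y hy
      · trivial
    · rintro ⟨h1, h2⟩ i hi
      rcases eq_or_ne i y with rfl | hne
      · simpa [hi] using h2
      · simpa [hne] using h1 i ⟨hne, hi⟩
  rw [hpre, Measure.prod_prod, oracleMeasure, Measure.infinitePi_pi _ fun i _ => ht i]
  split_ifs with hy
  · rw [mul_comm, Finset.mul_prod_erase s (fun i => (PMF.uniformOfFintype (Label lam)).toMeasure (t i)) hy]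
  · rw [Finset.erase_eq_of_notMem hy]
    simp

theorem oracleMeasure_eq_lintegral_update (y : List Bool) {E : Set (Oracle lam)}
    (hE : MeasurableSet E) : oracleMeasure lam E =
      ∫⁻ H, ({s : Label lam | Function.update H y s ∈ E}.ncard : ENNReal) / 2 ^ lam
        ∂oracleMeasure lam := by
  classical
  have hm := measurable_update_oracle (lam := lam) y
  conv_lhs => rw [← map_update_oracleMeasure y]
  rw [Measure.map_apply hm hE, Measure.prod_apply (hm hE)]
  congr 1
  funext H
  rw [PMF.toMeasure_uniformOfFintype_apply _ (Set.toFinite _).measurableSet,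
    Set.ncard_eq_toFinset_card', Set.toFinset_card]
  simp

/-- The point `T H` is random, so decompose by its value `y`. The event `T H = y` is unaffected by
resampling at `y`, so integrating out that coordinate costs a factor `k / 2 ^ lam` on it; the pieces
are disjoint and sum to at most one. -/
theorem oracleMeasure_le_of_resample_forall {E : Set (Oracle lam)} (hE : MeasurableSet E)
    {T : Oracle lam → List Bool} (hT : OracleMeasurable T)
    (hinv : ∀ H s, T (Function.update H (T H) s) = T H) {k : ℕ}
    (hk : ∀ H, {s : Label lam | Function.update H (T H) s ∈ E}.ncard ≤ k) :
    oracleMeasure lam E ≤ k / 2 ^ lam := by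
  -- The converse direction: writing the old value `H y` back undoes the update and, by `hinv`, does
  -- not move the point.
  have hinv' : ∀ H y s, T (Function.update H y s) = y → T H = y := by
    intro H y s h
    have := hinv (Function.update H y s) (H y)
    rw [h] at this
    simpa using this
  have hy : ∀ y, oracleMeasure lam (E ∩ T ⁻¹' {y}) ≤
      k / 2 ^ lam * oracleMeasure lam (T ⁻¹' {y}) := by
    intro y
    rw [oracleMeasure_eq_lintegral_update y (hE.inter (hT _)),
      ← lintegral_indicator_const (hT {y})]
    refine lintegral_mono fun H => ?_
    by_cases h : T H = y
    · rw [Set.indicator_of_mem (by simpa using h)]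
      gcongr
      refine le_trans (Set.ncard_le_ncard ?_ (Set.toFinite _)) (hk H)
      intro s hs
      rw [h]
      exact hs.1
    · have : {s : Label lam | Function.update H y s ∈ E ∩ T ⁻¹' {y}} = ∅ := by
        ext s
        simp only [Set.mem_ofPred_eq, Set.mem_empty_iff_false, iff_false]
        exact fun hs => h (hinv' H y s hs.2)
      rw [this]
      simp
  calc oracleMeasure lam E = oracleMeasure lam (⋃ y, E ∩ T ⁻¹' {y}) := by
        congr 1
        ext H
        simp
    _ ≤ ∑' y, oracleMeasure lam (E ∩ T ⁻¹' {y}) := measure_iUnion_le _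
    _ ≤ ∑' y, k / 2 ^ lam * oracleMeasure lam (T ⁻¹' {y}) := ENNReal.tsum_le_tsum hy
    _ = k / 2 ^ lam * oracleMeasure lam (⋃ y, T ⁻¹' {y}) := by
        rw [ENNReal.tsum_mul_left, measure_iUnion _ fun y => hT _]
        intro a b hab
        exact Disjoint.preimage T (by simpa using hab)
    _ ≤ k / 2 ^ lam * 1 := by gcongr; exact prob_le_one
    _ = k / 2 ^ lam := mul_one _

/-- If the point `T H` does not depend on the value of `H` there, and if for `H` in `E` at most `k`
values at that point keep `H` in `E`, then `E` has probability at most `k / 2 ^ lam`. -/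
theorem oracleMeasure_le_of_resample {E : Set (Oracle lam)} (hE : MeasurableSet E)
    {T : Oracle lam → List Bool} (hT : OracleMeasurable T)
    (hinv : ∀ H s, T (Function.update H (T H) s) = T H) {k : ℕ}
    (hk : ∀ H ∈ E, {s : Label lam | Function.update H (T H) s ∈ E}.ncard ≤ k) :
    oracleMeasure lam E ≤ k / 2 ^ lam := by
  refine oracleMeasure_le_of_resample_forall hE hT hinv fun H => ?_
  rcases Set.eq_empty_or_nonempty {s : Label lam | Function.update H (T H) s ∈ E} with h | ⟨s₀, hs₀⟩
  · simp [h]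
  -- The oracle updated by `s₀` lies in `E` and has the same resampling set as `H`, since a second
  -- update overrides the first.
  · have := hk _ hs₀
    rw [hinv] at this
    simpa only [Function.update_idem] using this

end Resample

/-! ## The prime labels -/

section LabelPrime

variable {lam : ℕ}

theorem labelPrime_prime (s : Label lam) : (labelPrime s).Prime :=
  Nat.prime_nth_prime _

theorem labelPrime_injective : Function.Injective (labelPrime : Label lam → ℕ) := by
  intro s t h
  have h' := Nat.nth_injective Nat.infinite_setOfPred_prime h
  funext i
  rw [← Nat.testBit_ofBits_lt s i i.2, h', Nat.testBit_ofBits_lt t i i.2]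

/-- Chebyshev's lower bound at `x = 2 ^ (lam + c)` gives about `x / (lam + c)` primes. Since `lam +
c ≤ 2 * lam` and `x ≥ 4 * lam * 2 ^ lam`, a factor of two is left to absorb the error term. -/
theorem two_pow_le_primeCounting {lam c : ℕ} (h1 : 4 * lam ≤ 2 ^ c) (hc : c ≤ lam)
    (hlam : 1 ≤ lam) : 2 ^ lam ≤ Nat.primeCounting (2 ^ (lam + c)) := by
  have hge := Chebyshev.pi_ge (2 ^ (lam + c))
  have hb : (1 : ℝ) ≤ (lam + c : ℕ) := by exact_mod_cast (by omega : 1 ≤ lam + c)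
  have hl2 : 0 < Real.log 2 := Real.log_pos one_lt_two
  have hlog : Real.log (((2 ^ (lam + c) : ℕ) : ℝ)) = (lam + c : ℕ) * Real.log 2 := by
    rw [Nat.cast_pow, Real.log_pow, Nat.cast_two]
  have hlog1 : Real.log (((2 ^ (lam + c) : ℕ) : ℝ) + 1) ≤ ((lam + c : ℕ) + 1) * Real.log 2 := by
    have : ((2 ^ (lam + c) : ℕ) : ℝ) + 1 ≤ 2 ^ (lam + c + 1) := by
      have : (1 : ℝ) ≤ 2 ^ (lam + c) := one_le_pow₀ one_le_two
      rw [pow_succ]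
      push_cast
      linarith
    calc _ ≤ Real.log (2 ^ (lam + c + 1)) := Real.log_le_log (by positivity) this
      _ = _ := by rw [Real.log_pow]; push_cast; ring
  rw [hlog, div_le_iff₀ (by positivity)] at hge
  have hge' : ((2 : ℝ) ^ (lam + c)) - ((lam + c : ℕ) + 1) ≤
      Nat.primeCounting (2 ^ (lam + c)) * (lam + c : ℕ) := by
    refine le_of_mul_le_mul_right ?_ hl2
    push_cast at hge hlog1 ⊢
    nlinarith
  by_contra! hlt
  have hlt' : (Nat.primeCounting (2 ^ (lam + c)) : ℝ) ≤ 2 ^ lam - 1 := by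
    have : (Nat.primeCounting (2 ^ (lam + c)) : ℝ) + 1 ≤ 2 ^ lam := by exact_mod_cast hlt
    linarith
  have h1' : (4 * lam : ℝ) ≤ 2 ^ c := by exact_mod_cast h1
  have hc' : (c : ℝ) ≤ lam := by exact_mod_cast hc
  have hlam' : (1 : ℝ) ≤ lam := by exact_mod_cast hlam
  have hp : (2 : ℝ) ≤ 2 ^ lam := by
    simpa using pow_le_pow_right₀ (one_le_two (α := ℝ)) hlam
  have h2 : (4 * lam : ℝ) * 2 ^ lam ≤ 2 ^ (lam + c) := by
    rw [pow_add, mul_comm]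
    gcongr
  have h3 : (Nat.primeCounting (2 ^ (lam + c)) : ℝ) * (lam + c : ℕ) ≤
      (2 ^ lam - 1) * (2 * lam) := by
    have : ((lam + c : ℕ) : ℝ) ≤ 2 * lam := by push_cast; linarith
    exact mul_le_mul hlt' this (by positivity) (by linarith)
  push_cast at *
  nlinarith

theorem labelPrime_lt (hlam : 4 ≤ lam) (s : Label lam) : labelPrime s < 2 ^ lam * (8 * lam) := by
  -- The least admissible exponent overshoots `4 * lam` by a factor below two, whence `8 * lam`.
  have h1 : 4 * lam ≤ 2 ^ Nat.clog 2 (4 * lam) := Nat.le_pow_clog one_lt_two _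
  have h4 : 4 * lam ≤ 2 ^ lam := by
    clear h1 s
    induction lam, hlam using Nat.le_induction with
    | base => norm_num
    | succ k hk ih => rw [pow_succ]; omega
  have hc : Nat.clog 2 (4 * lam) ≤ lam := Nat.clog_le_of_le_pow h4
  have h2 : 2 ^ Nat.clog 2 (4 * lam) < 8 * lam := by
    have := Nat.pow_pred_clog_lt_self one_lt_two (x := 4 * lam) (by omega)
    have hpos : 0 < Nat.clog 2 (4 * lam) := Nat.clog_pos one_lt_two (by omega)
    obtain ⟨d, hd⟩ := Nat.exists_eq_succ_of_ne_zero hpos.ne'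
    rw [hd] at this ⊢
    simp only [Nat.pred_succ, Nat.succ_eq_add_one, pow_succ] at this ⊢
    omega
  have h3 := two_pow_le_primeCounting h1 hc (by omega)
  have : labelPrime s < 2 ^ (lam + Nat.clog 2 (4 * lam)) + 1 :=
    Nat.nth_lt_of_lt_count ((Nat.ofBits_lt_two_pow s).trans_le h3)
  calc labelPrime s ≤ 2 ^ lam * 2 ^ Nat.clog 2 (4 * lam) := by rw [← pow_add]; omega
    _ < 2 ^ lam * (8 * lam) := by gcongr

/-- Numbers in one residue class are told apart by their quotients. Only size and injectivity
matter, so nothing about primes in progressions is needed. -/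
theorem ncard_labelPrime_mod_le {M : ℕ} (hM : ∀ s : Label lam, labelPrime s < M) (q a : ℕ) :
    {s : Label lam | labelPrime s % q = a}.ncard ≤ M / q + 1 := by
  have : {s : Label lam | labelPrime s % q = a}.ncard ≤
      ((Finset.range (M / q + 1) : Finset ℕ) : Set ℕ).ncard := by
    refine Set.ncard_le_ncard_of_injOn (fun s => labelPrime s / q) ?_ ?_ (Set.toFinite _)
    · intro s _
      simpa using Nat.lt_succ_of_le (Nat.div_le_div_right (hM s).le)
    · intro s hs t ht h
      apply labelPrime_injective
      rw [← Nat.div_add_mod (labelPrime s) q, ← Nat.div_add_mod (labelPrime t) q]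
      simp only at h
      rw [h, hs, ht]
  simpa [Set.ncard_coe_finset] using this

theorem ncard_labelPrime_eq_le (a : ℕ) : {s : Label lam | labelPrime s = a}.ncard ≤ 1 := by
  rw [Set.ncard_le_one (Set.toFinite _)]
  exact fun s hs t ht => labelPrime_injective (hs.trans ht.symm)

end LabelPrime

/-! ## Powers modulo a safe prime -/

/-- The unit group modulo `q` has order `2 * q'`. If `q'` did not divide the order of `a`, that
order would divide `2`, forcing `a` to be `±1`. So the exponents `r * b` and `r * c` agree modulo
`q'`, where `r` cancels. -/
theorem modEq_of_pow_modEq_safePrime {q q' a : ℕ} (hq : q.Prime) (hq' : q'.Prime)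
    (hqq : q = 2 * q' + 1) (h0 : a % q ≠ 0) (h1 : a % q ≠ 1) (h2 : a % q ≠ q - 1) {r b c : ℕ}
    (hr : ¬ q' ∣ r) (h : (a ^ r) ^ b ≡ (a ^ r) ^ c [MOD q]) : b ≡ c [MOD q'] := by
  have := Fact.mk hq
  have hq1 : 1 < q := hq.one_lt
  have hne : (a : ZMod q) ≠ 0 := by
    rwa [Ne, ZMod.natCast_eq_zero_iff, Nat.dvd_iff_mod_eq_zero]
  set u : (ZMod q)ˣ := Units.mk0 (a : ZMod q) hne with hu
  have hsq : u ^ 2 ≠ 1 := by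
    intro hs
    have hs' : (a : ZMod q) ^ 2 = 1 := by simpa [hu, Units.ext_iff] using hs
    rcases sq_eq_one_iff.mp hs' with h | h
    · have h' : ((a : ℕ) : ZMod q) = ((1 : ℕ) : ZMod q) := by simpa using h
      have := (ZMod.natCast_eq_natCast_iff _ _ _).mp h'
      exact h1 (by rw [this, Nat.mod_eq_of_lt hq1])
    · have h' : (((a + 1 : ℕ)) : ZMod q) = 0 := by simp [h]
      obtain ⟨k, hk⟩ := (ZMod.natCast_eq_zero_iff _ _).mp h'
      have hk0 : k ≠ 0 := by rintro rfl; simp at hk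
      obtain ⟨l, rfl⟩ := Nat.exists_eq_succ_of_ne_zero hk0
      have ha : a = (q - 1) + q * l := by
        rw [Nat.succ_eq_add_one, mul_add, mul_one] at hk
        omega
      exact h2 (by rw [ha, Nat.add_mul_mod_self_left, Nat.mod_eq_of_lt (by omega)])
  have hcard : orderOf u ∣ 2 * q' := by
    have := ZMod.card_units_eq_totient q ▸ orderOf_dvd_card (x := u)
    rwa [Nat.totient_prime hq, show q - 1 = 2 * q' by omega] at this
  have hdvd : q' ∣ orderOf u := by
    by_contra hnd
    have hcop : (orderOf u).Coprime q' := ((Nat.Prime.coprime_iff_not_dvd hq').mpr hnd).symm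
    exact hsq (orderOf_dvd_iff_pow_eq_one.mp (hcop.dvd_of_dvd_mul_right hcard))
  have hpow : u ^ (r * b) = u ^ (r * c) := by
    have := (ZMod.natCast_eq_natCast_iff _ _ _).mpr h
    rw [Units.ext_iff]
    simpa [hu, ← pow_mul] using this
  have hmod : r * b ≡ r * c [MOD q'] := (pow_eq_pow_iff_modEq.mp hpow).of_dvd hdvd
  exact Nat.ModEq.cancel_left_of_coprime (((Nat.Prime.coprime_iff_not_dvd hq').mpr hr)) hmod

/-! ## Bounds for a fixed security parameter -/

section Fixed

variable {lam : ℕ}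

/-- The label of every node is uniformly distributed. -/
theorem oracleMeasure_cpLabel_mem_le {n : ℕ} (hn : n < lam) (x v : List Bool) (hv : v.length ≤ n)
    (F : Set (Label lam)) {k : ℕ} (hF : F.ncard ≤ k) :
    oracleMeasure lam {H | cpLabel H x n v ∈ F} ≤ k / 2 ^ lam := by
  refine oracleMeasure_le_of_resample (OracleMeasurable.cpLabel x n v F)
    (OracleMeasurable.cpQuery x n v) (fun H s => cpQuery_update hn H x v hv s v le_rfl)
    fun H _ => ?_
  simpa only [Set.mem_preimage, cpLabel_update_self hn _ _ _ hv, Set.ofPred_mem_eq] using hF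

theorem eq_of_cpQuery_update_eq {n : ℕ} (hn : n < lam) (H : Oracle lam) (x : List Bool)
    {u v : List Bool} (huv : u ∈ cpParents n v) {s t : Label lam}
    (h : cpQuery (Function.update H (cpQuery H x n u) s) x n v =
      cpQuery (Function.update H (cpQuery H x n u) t) x n v) : s = t := by
  have hu := length_le_of_mem_cpParents huv
  have := cpLabel_congr_parents_of_cpQuery_eq h huv
  rwa [cpLabel_update_self hn _ _ _ hu, cpLabel_update_self hn _ _ _ hu] at this

theorem update_eq_of_notMem {H : Oracle lam} {z : List Bool} {l : List (List Bool)}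
    (hz : z ∉ l) (s : Label lam) : ∀ y ∈ l, Function.update H z s y = H y :=
  fun _ hy => Function.update_of_ne (ne_of_mem_of_not_mem hy hz) _ _

variable {α : Type}

/-- The query of `v` can hardly be guessed before the query of its parent `u` has been made. -/
theorem oracleMeasure_guess_le {n : ℕ} (hn : n < lam) (x : List Bool) {u v : List Bool}
    (huv : u ∈ cpParents n v) (pre : OracleAlg (Label lam) (List Bool))
    (online : List Bool → OracleAlg (Label lam) α) {w : ℕ} (hw : ∀ st, (online st).WidthLE w)
    (i : ℕ) :
    oracleMeasure lam {H | cpQuery H x n v ∈ (online (pre.run H)).roundQueries H i ∧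
      cpQuery H x n u ∉ pre.queries H ∧
      ∀ j : Fin i, cpQuery H x n u ∉ (online (pre.run H)).roundQueries H j} ≤ w / 2 ^ lam := by
  classical
  have hround : ∀ j, OracleMeasurable fun H => (online (pre.run H)).roundQueries H j := fun j =>
    (OracleMeasurable.run pre).bind (g := fun st H => (online st).roundQueries H j)
      fun st => OracleMeasurable.roundQueries (online st) j
  have hq := OracleMeasurable.cpQuery (lam := lam) x n
  have hu := length_le_of_mem_cpParents huv
  refine oracleMeasure_le_of_resample (T := fun H => cpQuery H x n u) (OracleMeasurable.setOf
    (((hq v).mem (hround i)).and (((hq u).mem (OracleMeasurable.queries pre)).not.and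
      (OracleMeasurable.all fun j : Fin i => ((hq u).mem (hround j)).not)))) (hq u)
    (fun H s => cpQuery_update hn H x u hu s u le_rfl) ?_
  rintro H ⟨-, hpre, hon⟩
  refine le_trans ?_ ((hw (pre.run H)).length_roundQueries_le H i)
  refine le_trans ?_ (List.toFinset_card_le _)
  rw [← Set.ncard_coe_finset]
  -- Resample the label of `u`. Its query has not been made, so the queries of round `i` stay fixed,
  -- while the query of `v` changes injectively with the label. At most `w` labels can hit.
  refine Set.ncard_le_ncard_of_injOn
    (fun s => cpQuery (Function.update H (cpQuery H x n u) s) x n v) ?_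
    (fun s _ t _ h => eq_of_cpQuery_update_eq hn H x huv h) (Finset.finite_toSet _)
  rintro s ⟨hs, -⟩
  rw [pre.run_congr (update_eq_of_notMem hpre s), OracleAlg.roundQueries_congr _ i
    fun j hj => update_eq_of_notMem (hon ⟨j, hj⟩) s] at hs
  simpa using hs

/-- Without the query of the root, the commitment can hardly be guessed. -/
theorem oracleMeasure_final_le {n : ℕ} (hn1 : 1 ≤ n) (hn : n < lam) {M m q q' : ℕ}
    (hM : ∀ s : Label lam, labelPrime s < M) (hq : q.Prime) (hq' : q'.Prime)
    (hqq : q = 2 * q' + 1) (hqm : q ∣ m) (x : List Bool)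
    (pre : OracleAlg (Label lam) (List Bool)) (online : List Bool → OracleAlg (Label lam) ℕ) :
    oracleMeasure lam {H | (online (pre.run H)).run H =
          labelPrime (H (x ++ List.replicate n false)) ^
            (∏ v ∈ cpNodes n, labelPrime (cpLabel H x n v)) % m ∧
        cpQuery H x n [] ∉ pre.queries H ∧ cpQuery H x n [] ∉ (online (pre.run H)).queries H ∧
        labelPrime (cpLabel H x n (List.replicate n false)) % q ∉ ({0, 1, q - 1} : Set ℕ) ∧
        ∀ v ∈ (cpNodes n).erase [], labelPrime (cpLabel H x n v) ≠ q'} ≤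
      (M / q' + 1 : ℕ) / 2 ^ lam := by
  classical
  have hlab := OracleMeasurable.cpLabel (lam := lam) x n
  have hqr := OracleMeasurable.cpQuery (lam := lam) x n []
  have hleaf : ∀ H : Oracle lam, H (x ++ List.replicate n false) =
      cpLabel H x n (List.replicate n false) := fun H => by
    rw [cpLabel_eq_cpQuery, cpQuery_replicate_false]
  have hroot : [] ∈ cpNodes n := by simp [mem_cpNodes]
  -- For `n ≥ 1` the leaf defining `p₀` is not the root, so resampling the root label keeps the base
  -- of the power.
  have hne : List.replicate n false ≠ [] := by
    rw [Ne, List.replicate_eq_nil_iff]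
    omega
  have hmem : List.replicate n false ∈ cpNodes n := by simp [mem_cpNodes]
  have hrun : OracleMeasurable fun H => (online (pre.run H)).run H :=
    (OracleMeasurable.run pre).bind (g := fun st H => (online st).run H)
      fun st => OracleMeasurable.run (online st)
  have hque : OracleMeasurable fun H => (online (pre.run H)).queries H :=
    (OracleMeasurable.run pre).bind (g := fun st H => (online st).queries H)
      fun st => OracleMeasurable.queries (online st)
  have hsolve : OracleMeasurable fun H : Oracle lam => labelPrime (H (x ++ List.replicate n false))
      ^ (∏ v ∈ cpNodes n, labelPrime (cpLabel H x n v)) % m :=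
    (OracleMeasurable.eval (x ++ List.replicate n false)).bind
      (g := fun b H => labelPrime b ^ (∏ v ∈ cpNodes n, labelPrime (cpLabel H x n v)) % m)
      fun b => (OracleMeasurable.prod _ fun v => (hlab v).comp labelPrime).comp
        fun e => labelPrime b ^ e % m
  have hwin := hrun.bind (g := fun b H => b = labelPrime (H (x ++ List.replicate n false)) ^
      (∏ v ∈ cpNodes n, labelPrime (cpLabel H x n v)) % m) fun b => hsolve.comp (b = ·)
  refine oracleMeasure_le_of_resample (T := fun H => cpQuery H x n []) (OracleMeasurable.setOf
    (hwin.and ((hqr.mem (OracleMeasurable.queries pre)).not.and ((hqr.mem hque).not.and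
      (((hlab (List.replicate n false)).comp fun l => labelPrime l % q ∉ ({0, 1, q - 1} : Set ℕ)).and
        (OracleMeasurable.all fun v => (hlab v).comp
          fun l => v ∈ (cpNodes n).erase [] → labelPrime l ≠ q')))))) hqr
    (fun H s => cpQuery_update hn H x [] (by simp) s [] le_rfl) ?_
  rintro H ⟨hout, hpre, hon, hp0, hρ⟩
  refine le_trans (Set.ncard_le_ncard ?_ (Set.toFinite _))
    (ncard_labelPrime_mod_le hM q' (labelPrime (cpLabel H x n []) % q'))
  rintro s ⟨hs, -⟩
  simp only [Set.mem_insert_iff, Set.mem_singleton_iff, not_or] at hp0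
  have hupd : ∀ v ∈ (cpNodes n).erase [],
      cpLabel (Function.update H (cpQuery H x n []) s) x n v = cpLabel H x n v := by
    intro v hv
    have hv' := (mem_cpNodes n v).mp (Finset.mem_of_mem_erase hv)
    exact cpLabel_update_of_lt hn H x [] (by simp) s v hv'
      (cpIndex_lt_root n v hv' (Finset.ne_of_mem_erase hv))
  have hprod : ∏ v ∈ (cpNodes n).erase [],
      labelPrime (cpLabel (Function.update H (cpQuery H x n []) s) x n v) =
      ∏ v ∈ (cpNodes n).erase [], labelPrime (cpLabel H x n v) :=
    Finset.prod_congr rfl fun v hv => by rw [hupd v hv]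
  -- Both oracles yield the same output, so both solutions agree. Splitting off the root factor
  -- leaves a congruence modulo `m` between two powers of `p₀ ^ r` whose exponents are the two root
  -- primes.
  rw [pre.run_congr (update_eq_of_notMem hpre s),
    OracleAlg.run_congr _ (update_eq_of_notMem hon s), hout, hleaf H,
    hleaf (Function.update H (cpQuery H x n []) s),
    hupd _ (Finset.mem_erase.mpr ⟨hne, hmem⟩), ← Finset.prod_erase_mul _ _ hroot,
    ← Finset.prod_erase_mul _ _ hroot, cpLabel_update_self hn H x [] (by simp) s,
    hprod, pow_mul, pow_mul] at hs
  refine (modEq_of_pow_modEq_safePrime hq hq' hqq hp0.1 hp0.2.1 hp0.2.2 ?_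
    (Nat.ModEq.of_dvd hqm hs)).symm
  intro hdvd
  obtain ⟨v, hv, hd⟩ := (hq'.prime.dvd_finsetProd_iff _).mp hdvd
  exact hρ v hv ((Nat.prime_dvd_prime_iff_eq hq' (labelPrime_prime _)).mp hd).symm

/-- The algorithm makes a query that extends the statement `x` by at most `K` bits. -/
def Touches {lam : ℕ} {α : Type} (K : ℕ) (A : OracleAlg (Label lam) α) (x : List Bool)
    (H : Oracle lam) : Prop :=
  ∃ y ∈ A.queries H, ∃ z : List Bool, y = x ++ z ∧ z.length ≤ K

theorem measurable_touches (K : ℕ) (A : OracleAlg (Label lam) α) (x : List Bool) :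
    MeasurableSet {H | Touches K A x H} :=
  ((OracleMeasurable.queries A).comp fun l =>
    ∃ y ∈ l, ∃ z : List Bool, y = x ++ z ∧ z.length ≤ K).setOf

/-- Double counting: for each oracle, a query has at most `K + 1` prefixes obtained by dropping at
most `K` bits, so at most `t * (K + 1)` statements are touched. -/
theorem sum_oracleMeasure_touches_le (K : ℕ) (A : OracleAlg (Label lam) α) {t : ℕ}
    (hA : A.QueriesLE t) (X : Finset (List Bool)) :
    ∑ x ∈ X, oracleMeasure lam {H | Touches K A x H} ≤ (t * (K + 1) : ℕ) := by
  classical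
  have h1 : ∀ x, oracleMeasure lam {H | Touches K A x H} =
      ∫⁻ H, Set.indicator {H | Touches K A x H} 1 H ∂oracleMeasure lam := fun x =>
    (lintegral_indicator_one (measurable_touches K A x)).symm
  simp_rw [h1]
  rw [← lintegral_finsetSum _ fun x _ => measurable_one.indicator (measurable_touches K A x)]
  refine (lintegral_mono (g := fun _ => ((t * (K + 1) : ℕ) : ENNReal)) fun H => ?_).trans
    (by simp)
  have h2 : ∑ x ∈ X, Set.indicator {H | Touches K A x H} (1 : Oracle lam → ENNReal) H =
      ((X.filter fun x => Touches K A x H).card : ENNReal) := by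
    simp [Set.indicator_apply]
  simp only [h2]
  rw [Nat.cast_le]
  calc (X.filter fun x => Touches K A x H).card
      ≤ (((A.queries H).toFinset ×ˢ Finset.range (K + 1)).image
          fun p => p.1.take (p.1.length - p.2)).card := by
        refine Finset.card_le_card fun x hx => ?_
        obtain ⟨-, y, hy, z, rfl, hz⟩ := Finset.mem_filter.mp hx
        refine Finset.mem_image.mpr ⟨(x ++ z, z.length), ?_, by simp⟩
        simp [hy]
        omega
    _ ≤ _ := Finset.card_image_le
    _ = (A.queries H).toFinset.card * (K + 1) := by simp
    _ ≤ t * (K + 1) := by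
        gcongr
        exact (List.toFinset_card_le _).trans (hA.length_queries_le H)

/-- If no query is guessed, the labels are queried one after the other. -/
theorem cpIndex_le_of_mem_roundQueries {n : ℕ} {H : Oracle lam} {x : List Bool}
    (A : OracleAlg (Label lam) α) {f : List Bool → List Bool}
    (hf : ∀ v : List Bool, v.length ≤ n → 1 < cpIndex n v →
      f v ∈ cpParents n v ∧ cpIndex n (f v) + 1 = cpIndex n v)
    (h : ∀ i, ∀ v : List Bool, v.length ≤ n → 1 < cpIndex n v →
      cpQuery H x n v ∈ A.roundQueries H i → ∃ j < i, cpQuery H x n (f v) ∈ A.roundQueries H j)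
    (i : ℕ) (v : List Bool) (hv : v.length ≤ n) (hi : cpQuery H x n v ∈ A.roundQueries H i) :
    cpIndex n v ≤ i + 1 := by
  induction i using Nat.strong_induction_on generalizing v with
  | _ i ih =>
    by_cases h1 : 1 < cpIndex n v
    · obtain ⟨hp, he⟩ := hf v hv h1
      obtain ⟨j, hj, hmem⟩ := h i v hv h1 hi
      have := ih j hj (f v) (length_le_of_mem_cpParents hp) hmem
      omega
    · omega

/-- The bound on the probability of success for fixed parameters, statement and coins. -/
theorem oracleMeasure_win_le {n : ℕ} (hn1 : 1 ≤ n) (hn : n < lam) {M m q q' : ℕ}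
    (hM : ∀ s : Label lam, labelPrime s < M) (hq : q.Prime) (hq' : q'.Prime)
    (hqq : q = 2 * q' + 1) (hqm : q ∣ m) (x : List Bool)
    (pre : OracleAlg (Label lam) (List Bool)) (online : List Bool → OracleAlg (Label lam) ℕ)
    {δ w : ℕ} (hδ : δ < 2 ^ (n + 1) - 1) (hr : ∀ st, (online st).RoundsLE δ)
    (hw : ∀ st, (online st).WidthLE w) :
    oracleMeasure lam {H | (online (pre.run H)).run H =
          labelPrime (H (x ++ List.replicate n false)) ^
            (∏ v ∈ cpNodes n, labelPrime (cpLabel H x n v)) % m} ≤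
      oracleMeasure lam {H | Touches (n + lam * (n + 1)) pre x H} +
        ((4 * (M / q' + 1) + (2 ^ (n + 1) - 1) + δ * (2 ^ (n + 1) - 1) * w : ℕ) : ENNReal) /
          2 ^ lam := by
  classical
  set P := oracleMeasure lam
  set leaf := List.replicate n false
  have hleaf : leaf.length ≤ n := by simp [leaf]
  -- `f` is the predecessor on the Hamiltonian path.
  choose! f hf using exists_cpParent_cpIndex n
  set nodes := (cpNodes n).filter fun v => 1 < cpIndex n v with hnodes
  set bad : Set (Oracle lam) := {H | Touches (n + lam * (n + 1)) pre x H}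
  set zero : Set (Oracle lam) :=
    {H | labelPrime (cpLabel H x n leaf) % q ∈ ({0, 1, q - 1} : Set ℕ)}
  set coll : List Bool → Set (Oracle lam) := fun v => {H | labelPrime (cpLabel H x n v) = q'}
  set guess : ℕ → List Bool → Set (Oracle lam) := fun i v =>
    {H | cpQuery H x n v ∈ (online (pre.run H)).roundQueries H i ∧
      cpQuery H x n (f v) ∉ pre.queries H ∧
      ∀ j : Fin i, cpQuery H x n (f v) ∉ (online (pre.run H)).roundQueries H j}
  set final : Set (Oracle lam) := {H | (online (pre.run H)).run H =
          labelPrime (H (x ++ List.replicate n false)) ^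
            (∏ v ∈ cpNodes n, labelPrime (cpLabel H x n v)) % m ∧
        cpQuery H x n [] ∉ pre.queries H ∧ cpQuery H x n [] ∉ (online (pre.run H)).queries H ∧
        labelPrime (cpLabel H x n leaf) % q ∉ ({0, 1, q - 1} : Set ℕ) ∧
        ∀ v ∈ (cpNodes n).erase [], labelPrime (cpLabel H x n v) ≠ q'}
  -- A win needs one of: a preprocessing query on `x`, a degenerate base, a label prime equal to
  -- `q'`, a guessed label, or a correct output without the root query.
  have hcover : {H | (online (pre.run H)).run H =
          labelPrime (H (x ++ List.replicate n false)) ^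
            (∏ v ∈ cpNodes n, labelPrime (cpLabel H x n v)) % m} ⊆
      bad ∪ (zero ∪ ((⋃ v ∈ cpNodes n, coll v) ∪
        ((⋃ p ∈ Finset.range δ ×ˢ nodes, guess p.1 p.2) ∪ final))) := by
    intro H hH
    by_contra hnot
    simp only [Set.mem_union, Set.mem_iUnion, not_or, not_exists] at hnot
    obtain ⟨hbad, hzero, hcoll, hguess, hfinal⟩ := hnot
    have hpre : ∀ v : List Bool, v.length ≤ n → cpQuery H x n v ∉ pre.queries H := by
      intro v hv hmem
      obtain ⟨z, hz, hlen⟩ := cpQuery_eq_append H x hv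
      exact hbad ⟨_, hmem, z, hz, hlen⟩
    have hstep : ∀ i, ∀ v : List Bool, v.length ≤ n → 1 < cpIndex n v →
        cpQuery H x n v ∈ (online (pre.run H)).roundQueries H i →
        ∃ j < i, cpQuery H x n (f v) ∈ (online (pre.run H)).roundQueries H j := by
      intro i v hv hi hmem
      by_contra! hno
      refine hguess (i, v) ?_ ⟨hmem, hpre _ (length_le_of_mem_cpParents (hf v hv hi).1),
        fun j => hno j j.2⟩
      simp [hnodes, mem_cpNodes, hv, hi, (hr _).lt_of_mem hmem]
    refine hfinal ⟨hH, hpre [] (by simp), ?_, hzero, fun v hv h =>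
      hcoll v (Finset.mem_of_mem_erase hv) h⟩
    intro hmem
    obtain ⟨i, hi⟩ := ((online (pre.run H)).mem_queries_iff _).mp hmem
    -- Rounds are counted from `0`: the root, of index `N`, would need `N ≤ i + 1 ≤ δ`, against `δ <
    -- N`.
    have h1 := cpIndex_le_of_mem_roundQueries _ hf hstep i [] (by simp) hi
    have h2 := (hr _).lt_of_mem hi
    rw [cpIndex_nil] at h1
    omega
  have hMq : M / q ≤ M / q' := Nat.div_le_div_left (by omega) hq'.pos
  -- Three forbidden residues of the base; the residue of the root prime in `final` supplies the
  -- fourth copy of `M / q' + 1`.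
  have hzero : P zero ≤ (3 * (M / q' + 1) : ℕ) / 2 ^ lam := by
    refine oracleMeasure_cpLabel_mem_le hn x leaf hleaf
      {s | labelPrime s % q ∈ ({0, 1, q - 1} : Set ℕ)} ?_
    have hset : {s : Label lam | labelPrime s % q ∈ ({0, 1, q - 1} : Set ℕ)} =
        {s | labelPrime s % q = 0} ∪ ({s | labelPrime s % q = 1} ∪
          {s | labelPrime s % q = q - 1}) := by
      ext s
      simp
    rw [hset]
    have h1 := Set.ncard_union_le {s : Label lam | labelPrime s % q = 0}
      ({s | labelPrime s % q = 1} ∪ {s | labelPrime s % q = q - 1})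
    have h2 := Set.ncard_union_le {s : Label lam | labelPrime s % q = 1}
      {s | labelPrime s % q = q - 1}
    have h3 := ncard_labelPrime_mod_le hM q 0
    have h4 := ncard_labelPrime_mod_le hM q 1
    have h5 := ncard_labelPrime_mod_le hM q (q - 1)
    omega
  have hcoll : P (⋃ v ∈ cpNodes n, coll v) ≤ (2 ^ (n + 1) - 1 : ℕ) / 2 ^ lam := by
    calc P (⋃ v ∈ cpNodes n, coll v) ≤ ∑ v ∈ cpNodes n, P (coll v) :=
          measure_biUnion_finset_le _ _
      _ ≤ ∑ v ∈ cpNodes n, ((1 : ℕ) : ENNReal) / 2 ^ lam := by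
          refine Finset.sum_le_sum fun v hv => ?_
          exact oracleMeasure_cpLabel_mem_le hn x v ((mem_cpNodes n v).mp hv)
            {s | labelPrime s = q'} (ncard_labelPrime_eq_le q')
      _ = ((cpNodes n).card : ENNReal) / 2 ^ lam := by
          rw [Finset.sum_const, nsmul_eq_mul, Nat.cast_one, mul_one_div]
      _ ≤ _ := by
          gcongr
          exact card_cpNodes_le n
  have hguess : P (⋃ p ∈ Finset.range δ ×ˢ nodes, guess p.1 p.2) ≤
      (δ * (2 ^ (n + 1) - 1) * w : ℕ) / 2 ^ lam := by
    calc P (⋃ p ∈ Finset.range δ ×ˢ nodes, guess p.1 p.2)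
        ≤ ∑ p ∈ Finset.range δ ×ˢ nodes, P (guess p.1 p.2) := measure_biUnion_finset_le _ _
      _ ≤ ∑ p ∈ Finset.range δ ×ˢ nodes, (w : ENNReal) / 2 ^ lam := by
          refine Finset.sum_le_sum fun p hp => ?_
          obtain ⟨hp1, hp2⟩ := Finset.mem_filter.mp (Finset.mem_product.mp hp).2
          exact oracleMeasure_guess_le hn x (hf p.2 ((mem_cpNodes _ _).mp hp1) hp2).1 pre online
            hw p.1
      _ = (δ * nodes.card * w : ℕ) / 2 ^ lam := by
          rw [Finset.sum_const, nsmul_eq_mul, Finset.card_product, Finset.card_range, mul_div_assoc']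
          push_cast
          rfl
      _ ≤ _ := by
          gcongr
          exact (Finset.card_filter_le _ _).trans (card_cpNodes_le n)
  have hfinal : P final ≤ (M / q' + 1 : ℕ) / 2 ^ lam :=
    oracleMeasure_final_le hn1 hn hM hq hq' hqq hqm x pre online
  calc _ ≤ P bad + (P zero + (P (⋃ v ∈ cpNodes n, coll v) +
        (P (⋃ p ∈ Finset.range δ ×ˢ nodes, guess p.1 p.2) + P final))) := by
        refine (measure_mono hcover).trans ((measure_union_le _ _).trans ?_)
        gcongr
        refine (measure_union_le _ _).trans ?_
        gcongr
        refine (measure_union_le _ _).trans ?_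
        gcongr
        exact measure_union_le _ _
    _ ≤ P bad + ((3 * (M / q' + 1) : ℕ) / 2 ^ lam + ((2 ^ (n + 1) - 1 : ℕ) / 2 ^ lam +
        ((δ * (2 ^ (n + 1) - 1) * w : ℕ) / 2 ^ lam + (M / q' + 1 : ℕ) / 2 ^ lam))) := by
        gcongr
    _ = _ := by
        rw [← ENNReal.add_div, ← ENNReal.add_div, ← ENNReal.add_div, ← Nat.cast_add,
          ← Nat.cast_add, ← Nat.cast_add]
        congr 3
        ring

end Fixed

/-! ## The probability of success -/

theorem PMF.tsum_bind_mul {α β : Type*} (p : PMF α) (f : α → PMF β) (g : β → ENNReal) :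
    ∑' b, (p.bind f) b * g b = ∑' a, p a * ∑' b, f a b * g b := by
  simp_rw [PMF.bind_apply, ← ENNReal.tsum_mul_right, ← ENNReal.tsum_mul_left]
  rw [ENNReal.tsum_comm]
  simp_rw [mul_assoc]

theorem PMF.tsum_pure_mul {α : Type*} (a : α) (g : α → ENNReal) :
    ∑' b, PMF.pure a b * g b = g a := by
  rw [tsum_eq_single a]
  · simp
  · intro b hb
    simp [hb]

theorem PMF.tsum_mul_le {α : Type*} (p : PMF α) {g : α → ENNReal} {c : ENNReal}
    (h : ∀ a ∈ p.support, g a ≤ c) : ∑' a, p a * g a ≤ c := by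
  calc ∑' a, p a * g a ≤ ∑' a, p a * c := by
        refine ENNReal.tsum_le_tsum fun a => ?_
        by_cases ha : a ∈ p.support
        · gcongr
          exact h a ha
        · simp [(p.apply_eq_zero_iff a).mpr ha]
    _ = c := by rw [ENNReal.tsum_mul_right, p.tsum_coe, one_mul]

theorem tsum_uniformOfFinset_touches_le {lam : ℕ} {α : Type} (K : ℕ)
    (A : OracleAlg (Label lam) α) {t : ℕ} (hA : A.QueriesLE t) {X : Finset (List Bool)}
    (hX : X.Nonempty) :
    ∑' x, PMF.uniformOfFinset X hX x * oracleMeasure lam {H | Touches K A x H} ≤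
      ((t * (K + 1) : ℕ) : ENNReal) / X.card := by
  rw [tsum_eq_sum (s := X) fun x hx => by
    rw [PMF.uniformOfFinset_apply_of_notMem hX hx, zero_mul]]
  rw [Finset.sum_congr rfl fun x hx => by rw [PMF.uniformOfFinset_apply_of_mem hX hx],
    ← Finset.mul_sum, mul_comm, ← div_eq_mul_inv]
  gcongr
  exact sum_oracleMeasure_touches_le K A hA X

section Setup

variable {P : PoSW} (A : Adversary P) {X : ℕ → Finset (List Bool)} (hX : ∀ lam, (X lam).Nonempty)
  (lam : ℕ)

theorem Adversary.setup_eq_bind : A.setup X hX lam =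
    (P.gen lam).bind fun pp => (PMF.uniformOfFinset (X lam) (hX lam)).bind fun x =>
      (PMF.uniformOfFintype (Fin (A.preCoins lam) → Bool)).bind fun r₀ =>
        (PMF.uniformOfFintype (Fin (A.coins lam) → Bool)).bind fun r₁ =>
          PMF.pure (pp, x, r₀, r₁) := rfl

theorem Adversary.tsum_setup_mul (g : P.Param × List Bool × (Fin (A.preCoins lam) → Bool) ×
    (Fin (A.coins lam) → Bool) → ENNReal) :
    ∑' e, A.setup X hX lam e * g e =
      ∑' pp, P.gen lam pp * ∑' x, PMF.uniformOfFinset (X lam) (hX lam) x *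
        ∑' r₀, PMF.uniformOfFintype (Fin (A.preCoins lam) → Bool) r₀ *
          ∑' r₁, PMF.uniformOfFintype (Fin (A.coins lam) → Bool) r₁ * g (pp, x, r₀, r₁) := by
  simp_rw [Adversary.setup_eq_bind, PMF.tsum_bind_mul, PMF.tsum_pure_mul]

/-- The preprocessing depends only on the parameters and its own coins. With these fixed first, the
statement is still uniform and the counting bound applies. -/
theorem Adversary.tsum_setup_touches_le {t K : ℕ} (ht : ∀ pp r, (A.pre lam pp r).QueriesLE t) :
    ∑' e, A.setup X hX lam e *
        oracleMeasure lam {H | Touches K (A.pre lam e.1 e.2.2.1) e.2.1 H} ≤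
      ((t * (K + 1) : ℕ) : ENNReal) / (X lam).card := by
  rw [Adversary.tsum_setup_mul]
  refine PMF.tsum_mul_le _ fun pp _ => ?_
  simp_rw [ENNReal.tsum_mul_right, PMF.tsum_coe, one_mul, ← ENNReal.tsum_mul_left]
  rw [ENNReal.tsum_comm]
  simp_rw [mul_left_comm _ (PMF.uniformOfFintype _ _), ENNReal.tsum_mul_left]
  exact PMF.tsum_mul_le _ fun r _ => tsum_uniformOfFinset_touches_le K _ (ht pp r) (hX lam)

theorem Adversary.mem_of_mem_support_setup {e} (he : e ∈ (A.setup X hX lam).support) :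
    e.1 ∈ (P.gen lam).support := by
  rw [Adversary.setup_eq_bind] at he
  simp only [PMF.mem_support_bind_iff, PMF.mem_support_pure_iff] at he
  obtain ⟨pp, hpp, x, -, r, -, r', -, rfl⟩ := he
  exact hpp

end Setup

/-- Take the larger factor; each safe prime is at most `3 * q'` for its larger half `q'`. -/
theorem IsSafePrimeProduct.exists_large_factor {m : ℕ} (h : IsSafePrimeProduct m) :
    ∃ q q' : ℕ, q.Prime ∧ q'.Prime ∧ q = 2 * q' + 1 ∧ q ∣ m ∧ m ≤ (3 * q') ^ 2 := by
  obtain ⟨p, q, ⟨hp, p', hp', hpp⟩, ⟨hq, q', hq', hqq⟩, rfl⟩ := h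
  have h1 := hp'.one_lt
  have h2 := hq'.one_lt
  rcases le_total p' q' with hle | hle
  · exact ⟨q, q', hq, hq', hqq, dvd_mul_left _ _, by
      rw [sq]; exact Nat.mul_le_mul (by omega) (by omega)⟩
  · exact ⟨p, p', hp, hp', hpp, dvd_mul_right _ _, by
      rw [sq]; exact Nat.mul_le_mul (by omega) (by omega)⟩

theorem Adversary.success_le {n : ℕ → ℕ} {modulus : ℕ → PMF ℕ}
    (A : Adversary (singleQueryPoSW n modulus)) {X : ℕ → Finset (List Bool)}
    (hX : ∀ lam, (X lam).Nonempty) {t δ w : ℕ → ℕ} (hA : A.RunsWithin t δ w) {lam : ℕ}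
    (hn1 : 1 ≤ n lam) (hn : n lam < lam) (hδ : δ lam < 2 ^ (n lam + 1) - 1) {M Q : ℕ}
    (hM : ∀ s : Label lam, labelPrime s < M) (hQ : 0 < Q)
    (hsafe : ∀ m ∈ (modulus lam).support, IsSafePrimeProduct m ∧ Q ^ 2 ≤ m) :
    A.success X hX lam ≤
      ((t lam * (n lam + lam * (n lam + 1) + 1) : ℕ) : ℝ) / (X lam).card +
        ((4 * (3 * M / Q + 1) + (2 ^ (n lam + 1) - 1) + δ lam * (2 ^ (n lam + 1) - 1) * w lam : ℕ) :
          ℝ) / 2 ^ lam := by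
  set C : ℕ := 4 * (3 * M / Q + 1) + (2 ^ (n lam + 1) - 1) + δ lam * (2 ^ (n lam + 1) - 1) * w lam
  set K : ℕ := n lam + lam * (n lam + 1)
  have hcard : ((X lam).card : ENNReal) ≠ 0 := by simpa using (hX lam).ne_empty
  have hpoint : ∀ e ∈ (A.setup X hX lam).support,
      oracleMeasure lam {H | (A.online lam ((A.pre lam e.1 e.2.2.1).run H) e.2.1 e.2.2.2).run H =
        (singleQueryPoSW n modulus).solve lam e.1 H e.2.1} ≤
      oracleMeasure lam {H | Touches K (A.pre lam e.1 e.2.2.1) e.2.1 H} + (C : ENNReal) / 2 ^ lam := by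
    intro e he
    obtain ⟨hsp, hm⟩ := hsafe e.1 (A.mem_of_mem_support_setup hX lam he)
    obtain ⟨q, q', hq, hq', hqq, hqm, hle⟩ := hsp.exists_large_factor
    have hQq : Q ≤ 3 * q' := (Nat.pow_le_pow_iff_left two_ne_zero).mp (hm.trans hle)
    refine (oracleMeasure_win_le hn1 hn hM hq hq' hqq hqm e.2.1 (A.pre lam e.1 e.2.2.1)
      (fun st => A.online lam st e.2.1 e.2.2.2) hδ (fun st => (hA.2 lam st e.2.1 e.2.2.2).1)
      fun st => (hA.2 lam st e.2.1 e.2.2.2).2).trans ?_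
    -- From `Q ^ 2 ≤ m ≤ (3 * q') ^ 2`. This replaces the factor `q'`, which varies with the
    -- modulus, by the uniform bound `Q`.
    have hdiv : M / q' ≤ 3 * M / Q := by
      rw [← Nat.mul_div_mul_left M q' three_pos]
      exact Nat.div_le_div_left hQq hQ
    simp only [C]
    gcongr
  have hsum : ∑' e, A.setup X hX lam e *
      oracleMeasure lam {H | (A.online lam ((A.pre lam e.1 e.2.2.1).run H) e.2.1 e.2.2.2).run H =
        (singleQueryPoSW n modulus).solve lam e.1 H e.2.1} ≤
      ((t lam * (K + 1) : ℕ) : ENNReal) / (X lam).card + (C : ENNReal) / 2 ^ lam := by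
    calc _ ≤ ∑' e, A.setup X hX lam e *
          (oracleMeasure lam {H | Touches K (A.pre lam e.1 e.2.2.1) e.2.1 H} +
            (C : ENNReal) / 2 ^ lam) := by
          refine ENNReal.tsum_le_tsum fun e => ?_
          by_cases he : e ∈ (A.setup X hX lam).support
          · gcongr
            exact hpoint e he
          · simp [(PMF.apply_eq_zero_iff _ e).mpr he]
      _ ≤ _ := by
          rw [tsum_congr fun e => mul_add _ _ _, ENNReal.tsum_add, ENNReal.tsum_mul_right, PMF.tsum_coe, one_mul]
          gcongr
          exact A.tsum_setup_touches_le hX lam fun pp r => hA.1 lam pp r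
  have h1 : ((t lam * (K + 1) : ℕ) : ENNReal) / (X lam).card ≠ ⊤ :=
    ENNReal.div_ne_top (ENNReal.natCast_ne_top _) hcard
  have h2 : (C : ENNReal) / 2 ^ lam ≠ ⊤ :=
    ENNReal.div_ne_top (ENNReal.natCast_ne_top _) (by simp)
  have := ENNReal.toReal_mono (ENNReal.add_ne_top.mpr ⟨h1, h2⟩) hsum
  rw [ENNReal.toReal_add h1 h2, ENNReal.toReal_div, ENNReal.toReal_div] at this
  simp only [ENNReal.toReal_natCast, ENNReal.toReal_pow, ENNReal.toReal_ofNat] at this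
  exact this

/-! ## Asymptotics -/

theorem negligible_of_le {f : ℕ → ℝ} (h0 : ∀ lam, 0 ≤ f lam)
    (h : ∀ c : ℕ, ∃ C : ℝ, ∀ᶠ lam : ℕ in atTop, f lam ≤ C / (lam : ℝ) ^ c) : Negligible f := by
  intro c
  obtain ⟨C, hC⟩ := h (c + 1)
  refine squeeze_zero' (Eventually.of_forall fun lam => mul_nonneg (by positivity) (h0 lam)) ?_
    (tendsto_const_div_atTop_nhds_zero_nat C)
  filter_upwards [hC, eventually_gt_atTop 0] with lam hlam hpos
  have hpos' : (0 : ℝ) < lam := by exact_mod_cast hpos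
  calc (lam : ℝ) ^ c * f lam ≤ (lam : ℝ) ^ c * (C / (lam : ℝ) ^ (c + 1)) := by gcongr
    _ = C / lam := by rw [pow_succ]; field_simp

/-- The only place where the full strength of `n = o(lam)` enters: it makes `N` subexponential.
After squaring, the power of `lam` and the power of `2 ^ (n + 1)` are each compared with one factor
`2 ^ lam`. -/
theorem eventually_pow_le_two_pow {n : ℕ → ℕ}
    (hsub : (fun lam => (n lam : ℝ)) =o[atTop] (fun lam : ℕ => (lam : ℝ))) (d : ℕ) :
    ∀ᶠ lam : ℕ in atTop, (lam + (2 ^ (n lam + 1) - 1)) ^ d ≤ 2 ^ lam := by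
  -- Chosen so that `2 * d * n` and `2 * d` each take at most half of `lam`.
  have h1 := hsub.def (c := 1 / (4 * (d + 1))) (by positivity)
  have h2 : ∀ᶠ lam : ℕ in atTop, lam ^ (2 * d) ≤ 2 ^ lam := by
    have := (isLittleO_pow_const_const_pow_of_one_lt (R := ℝ) (2 * d) one_lt_two).def
      (c := 1) one_pos
    filter_upwards [this] with lam h
    have h' : ((lam ^ (2 * d) : ℕ) : ℝ) ≤ ((2 ^ lam : ℕ) : ℝ) := by simpa using h
    exact_mod_cast h'
  filter_upwards [h1, h2, eventually_ge_atTop (4 * (d + 1))] with lam h1 h2 h3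
  have hn : 4 * (d + 1) * n lam ≤ lam := by
    simp only [Real.norm_natCast] at h1
    rw [div_mul_eq_mul_div, one_mul, le_div_iff₀ (by positivity)] at h1
    have : (n lam : ℝ) * (4 * (d + 1)) = ((4 * (d + 1) * n lam : ℕ) : ℝ) := by push_cast; ring
    rw [this] at h1
    exact_mod_cast h1
  have hexp : (n lam + 1) * (2 * d) ≤ lam := by nlinarith
  have hbase : lam + (2 ^ (n lam + 1) - 1) ≤ lam * 2 ^ (n lam + 1) := by
    obtain ⟨a, ha⟩ := Nat.exists_eq_succ_of_ne_zero (Nat.two_pow_pos (n lam + 1)).ne'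
    rw [ha, Nat.succ_sub_one, Nat.mul_succ, add_comm]
    gcongr
    exact Nat.le_mul_of_pos_left a (by omega)
  refine (Nat.pow_le_pow_iff_left two_ne_zero).mp ?_
  calc ((lam + (2 ^ (n lam + 1) - 1)) ^ d) ^ 2 ≤ ((lam * 2 ^ (n lam + 1)) ^ d) ^ 2 := by gcongr
    _ = lam ^ (2 * d) * 2 ^ ((n lam + 1) * (2 * d)) := by ring
    _ ≤ 2 ^ lam * 2 ^ lam := by gcongr; norm_num
    _ = (2 ^ lam) ^ 2 := (sq _).symm

theorem singleQueryPoSW_isSequential (n : ℕ → ℕ) (hn : ∀ lam, 1 ≤ n lam)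
    (hsub : (fun lam => (n lam : ℝ)) =o[atTop] (fun lam : ℕ => (lam : ℝ)))
    (modulus : ℕ → PMF ℕ)
    (hsafe : ∀ lam, ∀ m ∈ (modulus lam).support, IsSafePrimeProduct m)
    (hsize : ∀ c : ℕ, ∀ᶠ lam : ℕ in atTop, ∀ m ∈ (modulus lam).support, lam ^ c ≤ m)
    (X : ℕ → Finset (List Bool)) (hX : ∀ lam, (X lam).Nonempty)
    (hXsize : ∀ c : ℕ, ∀ᶠ lam : ℕ in atTop,
      (lam + (2 ^ (n lam + 1) - 1)) ^ c ≤ (X lam).card)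
    (δ : ℕ → ℕ) (hδ : ∀ lam, δ lam < 2 ^ (n lam + 1) - 1) :
    (singleQueryPoSW n modulus).IsSequential X hX δ := by
  rintro t w A ⟨a, ht⟩ ⟨b, hw⟩ hA
  refine negligible_of_le (fun lam => ENNReal.toReal_nonneg) fun c =>
    -- One summand per source: preprocessing queries, residues of primes (`96 = 4 * 3 * 8`), and
    -- guesses together with the lower-order terms.
    ⟨3 * a + 96 + (5 + b), ?_⟩
  -- With `S = lam + N`, the numerators are of order `S ^ (b + 2)` and `S ^ (a + 2)`; the extra `c`
  -- is the decay wanted. The modulus must exceed the square of `Q = lam ^ (c + 1)`, whose spare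
  -- power of `lam` cancels the `8 * lam` in the size of the primes.
  filter_upwards [eventually_pow_le_two_pow hsub (b + 2 + c), hXsize (a + 2 + c),
    hsize ((c + 1) * 2), hsub.def (c := 1 / 2) (by norm_num), eventually_ge_atTop 4]
    with lam hpow hXc hmod hnl hlam
  have hnlam : n lam < lam := by
    simp only [Real.norm_natCast] at hnl
    have : (4 : ℝ) ≤ lam := by exact_mod_cast hlam
    have : (n lam : ℝ) < lam := by linarith
    exact_mod_cast this
  have hbound := A.success_le hX hA (hn lam) hnlam (hδ lam) (labelPrime_lt hlam)
    (Q := lam ^ (c + 1)) (by positivity) fun m hm => ⟨hsafe lam m hm, by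
      rw [← pow_mul]; exact hmod m hm⟩
  refine hbound.trans ?_
  have ht := ht lam
  have hw := hw lam
  have hδ := hδ lam
  simp only [singleQueryPoSW] at ht hw
  have hnN : n lam + 1 ≤ 2 ^ (n lam + 1) - 1 := by
    have h1 : n lam < 2 ^ n lam := Nat.lt_two_pow_self
    have h2 := hn lam
    rw [pow_succ]
    omega
  set N := 2 ^ (n lam + 1) - 1 with hN
  set S := lam + N with hS
  have hS1 : 1 ≤ S := by omega
  have hlamR : (0 : ℝ) < lam := by exact_mod_cast (by omega : 0 < lam)
  have hSR : (0 : ℝ) < S := by exact_mod_cast hS1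
  have hlamS : (lam : ℝ) ^ c ≤ (S : ℝ) ^ c := by
    gcongr
    exact_mod_cast (by omega : lam ≤ S)
  have hterm1 : ((t lam * (n lam + lam * (n lam + 1) + 1) : ℕ) : ℝ) / (X lam).card ≤
      3 * a / (lam : ℝ) ^ c := by
    have hK : n lam + lam * (n lam + 1) + 1 ≤ 3 * S ^ 2 := by
      have h1 : lam * (n lam + 1) ≤ S * S := Nat.mul_le_mul (by omega) (by omega)
      have h2 : S ≤ S * S := Nat.le_mul_self S
      rw [sq]
      omega
    have hnum : t lam * (n lam + lam * (n lam + 1) + 1) ≤ a * S ^ a * (3 * S ^ 2) :=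
      Nat.mul_le_mul ht hK
    calc ((t lam * (n lam + lam * (n lam + 1) + 1) : ℕ) : ℝ) / (X lam).card
        ≤ ((a * S ^ a * (3 * S ^ 2) : ℕ) : ℝ) / ((S ^ (a + 2 + c) : ℕ) : ℝ) := by
          gcongr
      _ = 3 * a / (S : ℝ) ^ c := by
          push_cast
          rw [pow_add, pow_add]
          field_simp
      _ ≤ 3 * a / (lam : ℝ) ^ c := by gcongr
  have hterm2 : ((4 * (3 * (2 ^ lam * (8 * lam)) / lam ^ (c + 1)) : ℕ) : ℝ) / 2 ^ lam ≤
      96 / (lam : ℝ) ^ c := by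
    have hdiv : ((3 * (2 ^ lam * (8 * lam)) / lam ^ (c + 1) : ℕ) : ℝ) ≤
        3 * (2 ^ lam * (8 * lam)) / (lam : ℝ) ^ (c + 1) :=
      Nat.cast_div_le.trans (by push_cast; rfl)
    rw [Nat.cast_mul, div_le_iff₀ (by positivity)]
    calc ((4 : ℕ) : ℝ) * ((3 * (2 ^ lam * (8 * lam)) / lam ^ (c + 1) : ℕ) : ℝ)
        ≤ (4 : ℕ) * (3 * (2 ^ lam * (8 * lam)) / (lam : ℝ) ^ (c + 1)) := by gcongr
      _ = 96 / (lam : ℝ) ^ c * 2 ^ lam := by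
          rw [pow_succ]
          field_simp
          norm_num
  have hterm3 : ((4 + N + δ lam * N * w lam : ℕ) : ℝ) / 2 ^ lam ≤ (5 + b) / (lam : ℝ) ^ c := by
    have hnum : 4 + N + δ lam * N * w lam ≤ (5 + b) * S ^ (b + 2) := by
      have h1 : δ lam * N * w lam ≤ S * S * (b * S ^ b) := by
        gcongr <;> omega
      have h2 : S ≤ S ^ (b + 2) := Nat.le_self_pow (by omega) S
      calc 4 + N + δ lam * N * w lam ≤ 5 * S + S * S * (b * S ^ b) := by omega
        _ ≤ 5 * S ^ (b + 2) + S * S * (b * S ^ b) := by gcongr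
        _ = _ := by ring
    calc ((4 + N + δ lam * N * w lam : ℕ) : ℝ) / 2 ^ lam
        ≤ (((5 + b) * S ^ (b + 2) : ℕ) : ℝ) / ((S ^ (b + 2 + c) : ℕ) : ℝ) := by
          gcongr
          exact_mod_cast hpow
      _ = (5 + b) / (S : ℝ) ^ c := by
          push_cast
          rw [pow_add _ (b + 2) c]
          field_simp
      _ ≤ (5 + b) / (lam : ℝ) ^ c := by gcongr
  have hsplit : ((4 * (3 * (2 ^ lam * (8 * lam)) / lam ^ (c + 1) + 1) + N + δ lam * N * w lam : ℕ) :
      ℝ) / 2 ^ lam = ((4 * (3 * (2 ^ lam * (8 * lam)) / lam ^ (c + 1)) : ℕ) : ℝ) / 2 ^ lam +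
        ((4 + N + δ lam * N * w lam : ℕ) : ℝ) / 2 ^ lam := by
    rw [← add_div, ← Nat.cast_add]
    congr 2
    ring
  rw [hsplit, add_div, add_div]
  linarith

/-- The first part follows from the second, which refutes its hypothesis: in the random oracle model
no adversary with fewer than `N` rounds has a non-negligible probability of success. -/
theorem mainTheorem2 (n : ℕ → ℕ) (hn : ∀ lam, 1 ≤ n lam)
    (hsub : (fun lam => (n lam : ℝ)) =o[atTop] (fun lam : ℕ => (lam : ℝ)))
    (modulus : ℕ → PMF ℕ)
    (hsafe : ∀ lam, ∀ m ∈ (modulus lam).support, IsSafePrimeProduct m)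
    (hsize : ∀ c : ℕ, ∀ᶠ lam : ℕ in atTop, ∀ m ∈ (modulus lam).support, lam ^ c ≤ m)
    (X : ℕ → Finset (List Bool)) (hX : ∀ lam, (X lam).Nonempty)
    (hXsize : ∀ c : ℕ, ∀ᶠ lam : ℕ in atTop,
      (lam + (2 ^ (n lam + 1) - 1)) ^ c ≤ (X lam).card) :
    (∀ (t δ w : ℕ → ℕ) (A : Adversary (singleQueryPoSW n modulus)) (pwin : ℕ → ℝ),
      (singleQueryPoSW n modulus).BreaksSequentiality X hX t δ w A pwin →
        ∃ A' : Adversary (cpPoSW n), (cpPoSW n).BreaksSequentiality X hX t δ w A' pwin) ∧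
    (∀ δ : ℕ → ℕ, (∀ lam, δ lam < 2 ^ (n lam + 1) - 1) →
      (singleQueryPoSW n modulus).IsSequential X hX δ) := by
  have hseq := singleQueryPoSW_isSequential n hn hsub modulus hsafe hsize X hX hXsize
  refine ⟨fun t δ w A pwin ⟨ht, hw, hδ, hA, hwin, hnegl⟩ => absurd ?_ hnegl, hseq⟩
  rw [← funext hwin]
  exact hseq δ hδ t w A ht hw hA
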